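/- Let $d\ge 1$, let $K\subseteq\mathbb R^d$ be measurable with positive Lebesgue measure, and let $\rho\colon K\to(0,\infty)$ be Lebesgue integrable. Let $\pi$ be the probability measure on $K$ with $\pi(A)=\int_A\rho(x)\,dx\big/\int_K\rho(x)\,dx$, and let $L_2(\pi)$ carry the inner product $\langle f,g\rangle_\pi=\int_K fg\,d\pi$. Let $\sigma$ be the uniform distribution on the Euclidean unit sphere $S^{d-1}$. For $t\ge 0$, $x\in K$, $\theta\in S^{d-1}$ put $K(t)=\{y\in K:\rho(y)>t\}$, $L_t(x,\theta)=\{x+s\theta: s\in\mathbb R\}\cap K(t)$ and $L(x,\theta)=L_0(x,\theta)$. Let $|\cdot|$ and $dz$ on lines denote one-dimensional Lebesgue measure and $\mathrm{vol}_d$ Lebesgue measure on $\mathbb R^d$. Let $q\colon\mathbb R^d\to[0,\infty)$ be a probability density that is rotationally invariant, i.e. $q(r\theta_1)=q(r\theta_2)$ for all $r\in\mathbb R$, $\theta_1,\theta_2\in S^{d-1}$. Consider the following transition kernels on $K$ (defined for $\pi$-almost every $x$): - lazy random walk Metropolis: for measurable $A\subseteq K$ with $x\notin A$, $M(x,A)=\frac12\int_A\min\{1,\rho(y)/\rho(x)\}\,q(y-x)\,dy$,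 and $M(x,\{x\})=1-M(x,K\setminus\{x\})$; - hybrid slice sampler based on hit-and-run: $U(x,A)=\frac1{\rho(x)}\int_0^{\rho(x)}\int_{S^{d-1}}\frac{|L_t(x,\theta)\cap A|}{|L_t(x,\theta)|}\,d\sigma(\theta)\,dt$; - hit-and-run: $H(x,A)=\int_{S^{d-1}}\frac{\int_{L(x,\theta)}\mathbf 1_A(z)\rho(z)\,dz}{\int_{L(x,\theta)}\rho(z)\,dz}\,d\sigma(\theta)$; - simple slice sampler: $S(x,A)=\frac1{\rho(x)}\int_0^{\rho(x)}\frac{\mathrm{vol}_d(A\cap K(t))}{\mathrm{vol}_d(K(t))}\,dt$. Each kernel $P\in\{M,U,H,S\}$ induces a bounded Markov operator on $L_2(\pi)$, also denoted $P$, by $Pf(x)=\int_K f(y)\,P(x,dy)$ for $\pi$-almost every $x$. These operators satisfy, for all $f\in L_2(\pi)$, $$\langle Mf,f\rangle_\pi\ \ge\ \langle Uf,f\rangle_\pi\ \ge\ \langle Hf,f\rangle_\pi\qquad\text{and}\qquad \langle Mf,f\rangle_\pi\ \ge\ \langle Uf,f\rangle_\pi\ \ge\ \langle Sf,f\rangle_\pi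 .$$ -/

import Mathlib

open MeasureTheory Set
open scoped ENNReal

noncomputable section

namespace Samplers

/-- The measure `μ` rescaled to total mass one (meaningful if `0 < μ univ < ∞`). -/
def normalized {α : Type*} [MeasurableSpace α] (μ : Measure α) : Measure α :=
  (μ univ)⁻¹ • μ

variable {d : ℕ}

/-- The target distribution `π(A) = ∫_A ρ dx / ∫_K ρ dx`, `A ⊆ K`, as a measure on `ℝ^d`
concentrated on `K`. -/
def target (K : Set (EuclideanSpace ℝ (Fin d))) (ρ : EuclideanSpace ℝ (Fin d) → ℝ) :
    Measure (EuclideanSpace ℝ (Fin d)) :=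
  normalized ((volume.restrict K).withDensity fun x => ENNReal.ofReal (ρ x))

/-- The uniform distribution on the Euclidean unit sphere. -/
def sphereUniform (d : ℕ) : Measure (Metric.sphere (0 : EuclideanSpace ℝ (Fin d)) 1) :=
  normalized (volume : Measure (EuclideanSpace ℝ (Fin d))).toSphere

/-- One-dimensional Lebesgue measure on the line `{x + s θ | s ∈ ℝ}`; for a unit vector `θ` the
parametrization `s ↦ x + s θ` is an isometry. -/
def lineMeasure (x : EuclideanSpace ℝ (Fin d)) (θ : Metric.sphere (0 : EuclideanSpace ℝ (Fin d)) 1) :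
    Measure (EuclideanSpace ℝ (Fin d)) :=
  Measure.map (fun s : ℝ => x + s • (θ : EuclideanSpace ℝ (Fin d))) volume

/-- The chord in `G` through `x` in direction `θ`. -/
def chord (G : Set (EuclideanSpace ℝ (Fin d))) (x : EuclideanSpace ℝ (Fin d))
    (θ : Metric.sphere (0 : EuclideanSpace ℝ (Fin d)) 1) : Set (EuclideanSpace ℝ (Fin d)) :=
  {z | z ∈ G ∧ ∃ s : ℝ, z = x + s • (θ : EuclideanSpace ℝ (Fin d))}

/-- The level set `K(t) = {x ∈ K | ρ(x) > t}`. -/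
def levelSet (K : Set (EuclideanSpace ℝ (Fin d))) (ρ : EuclideanSpace ℝ (Fin d) → ℝ) (t : ℝ) :
    Set (EuclideanSpace ℝ (Fin d)) :=
  {x | x ∈ K ∧ t < ρ x}

/-- Hit-and-run: sample `θ` uniformly on the sphere, then sample from the distribution
proportional to `ρ` on the chord of `K` through `x` in direction `θ`. -/
def hitAndRun (K : Set (EuclideanSpace ℝ (Fin d))) (ρ : EuclideanSpace ℝ (Fin d) → ℝ)
    (x : EuclideanSpace ℝ (Fin d)) : Measure (EuclideanSpace ℝ (Fin d)) :=
  (sphereUniform d).bind fun θ =>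
    normalized (((lineMeasure x θ).restrict (chord K x θ)).withDensity
      fun z => ENNReal.ofReal (ρ z))

/-- Simple slice sampler: sample `t` uniformly on `(0, ρ(x))`, then sample uniformly on `K(t)`. -/
def simpleSlice (K : Set (EuclideanSpace ℝ (Fin d))) (ρ : EuclideanSpace ℝ (Fin d) → ℝ)
    (x : EuclideanSpace ℝ (Fin d)) : Measure (EuclideanSpace ℝ (Fin d)) :=
  (normalized (volume.restrict (Ioo 0 (ρ x)))).bind fun t =>
    normalized (volume.restrict (levelSet K ρ t))

/-- Hybrid slice sampler based on hit-and-run: sample independently `t` uniformly on `(0, ρ(x))`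
and `θ` uniformly on the sphere, then sample uniformly on the chord of `K(t)` through `x` in
direction `θ`. -/
def hybridSlice (K : Set (EuclideanSpace ℝ (Fin d))) (ρ : EuclideanSpace ℝ (Fin d) → ℝ)
    (x : EuclideanSpace ℝ (Fin d)) : Measure (EuclideanSpace ℝ (Fin d)) :=
  ((normalized (volume.restrict (Ioo 0 (ρ x)))).prod (sphereUniform d)).bind fun p =>
    normalized ((lineMeasure x p.2).restrict (chord (levelSet K ρ p.1) x p.2))

/-- The acceptance probability: `min {1, ρ(y)/ρ(x)}` for `x, y ∈ K`, and `0` otherwise. -/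
def acceptance (K : Set (EuclideanSpace ℝ (Fin d))) (ρ : EuclideanSpace ℝ (Fin d) → ℝ)
    (x y : EuclideanSpace ℝ (Fin d)) : ℝ :=
  (K ×ˢ K).indicator (fun p => min 1 (ρ p.2 / ρ p.1)) (x, y)

/-- The part of the lazy random walk Metropolis transition that comes from accepted proposals:
`A ↦ (1/2) ∫_K 1_A(y) α(x,y) q(y-x) dy`. -/
def metropolisMove (K : Set (EuclideanSpace ℝ (Fin d))) (ρ q : EuclideanSpace ℝ (Fin d) → ℝ)
    (x : EuclideanSpace ℝ (Fin d)) : Measure (EuclideanSpace ℝ (Fin d)) :=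
  (volume.restrict K).withDensity fun y =>
    ENNReal.ofReal (1 / 2 * (acceptance K ρ x y * q (y - x)))

/-- Lazy random walk Metropolis with proposal density `q`: the remaining mass stays at `x`. -/
def metropolis (K : Set (EuclideanSpace ℝ (Fin d))) (ρ q : EuclideanSpace ℝ (Fin d) → ℝ)
    (x : EuclideanSpace ℝ (Fin d)) : Measure (EuclideanSpace ℝ (Fin d)) :=
  metropolisMove K ρ q x + (1 - metropolisMove K ρ q x (K \ {x})) • Measure.dirac x

/-- `q` is a rotationally invariant probability density on `ℝ^d`. -/
structure IsRotInvDensity (q : EuclideanSpace ℝ (Fin d) → ℝ) : Prop where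
  measurable : Measurable q
  nonneg : ∀ z, 0 ≤ q z
  integral_eq_one : ∫ z, q z = 1
  rotInv : ∀ (r : ℝ) (θ₁ θ₂ : Metric.sphere (0 : EuclideanSpace ℝ (Fin d)) 1),
    q (r • (θ₁ : EuclideanSpace ℝ (Fin d))) = q (r • (θ₂ : EuclideanSpace ℝ (Fin d)))

/-- `P` is the Markov operator on `L_2(π)` induced by the transition probabilities `κ(x, dy)`:
these are probability measures for `π`-almost every `x`, and for every square integrable `f`
(any representative) `P f (x) = ∫ f(y) κ(x, dy)` for `π`-almost every `x`, with `f` integrable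
with respect to `κ(x, ·)`. These properties determine `P`. -/
structure IsMarkovOperator {α : Type*} [MeasurableSpace α] (π : Measure α) (κ : α → Measure α)
    (P : Lp ℝ 2 π →L[ℝ] Lp ℝ 2 π) : Prop where
  isProb : ∀ᵐ x ∂π, IsProbabilityMeasure (κ x)
  apply_ae : ∀ (f : α → ℝ) (hf : MemLp f 2 π),
    ∀ᵐ x ∂π, Integrable f (κ x) ∧ P (hf.toLp f) x = ∫ y, f y ∂(κ x)

/-- The covariance ordering `P₁ ≥ P₂`: `⟨P₁ f, f⟩_π ≥ ⟨P₂ f, f⟩_π` for all `f ∈ L_2(π)`. -/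
def CovGE {α : Type*} [MeasurableSpace α] {π : Measure α}
    (P₁ P₂ : Lp ℝ 2 π →L[ℝ] Lp ℝ 2 π) : Prop :=
  ∀ f : Lp ℝ 2 π, inner ℝ (P₁ f) f ≥ inner ℝ (P₂ f) f

end Samplers

end

/-! For a kernel `P` leaving `π` invariant, the Dirichlet form `∫∫ (f x - f y)² P(x,dy) π(dx)`
equals `2(‖f‖² - ⟨Pf, f⟩)`, so the covariance ordering is the reverse ordering of Dirichlet forms
(`covGE_of_dirichlet_le`). The forms take values in `[0, ∞]` and make sense for every measurable
`f`, so they can be compared by Tonelli arguments without integrability conditions.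

The forms of U, H and S are mixtures of forms of averaging kernels, which resample from a
conditional distribution. The form of such a kernel `κ` with respect to `μ` is `2 ∫ (f - κf)² dμ`,
and it is at most `2 ∫ (f - g)² dμ` for every `g` that is constant on the sets where `κ` resamples
(`IsAveraging.dirichlet_eq`, `IsAveraging.dirichlet_le`). The layer-cake formula writes `ρ dx` as
the integral over `t > 0` of Lebesgue measure on `K(t)`. The form of U is then an integral over `t`
and `θ` of forms for the chords of `K(t)`. Taking `g` to be the mean of `f` over `K(t)` gives U ≥ S;
taking `g` to be the `ρ`-weighted mean over the full chord gives U ≥ H.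

For M, detailed balance produces the weight `min(ρ x, ρ y) q(y - x) / 2`, and the minimum is the
integral over `t` of the product of the indicators of `K(t)` at `x` and `y`. In polar coordinates
for `y - x`, a step stays on one line, where `(a - b)² ≤ 2(a - m)² + 2(b - m)²` with `m` the chord
mean bounds its cost by twice the form of the chord kernel (`lintegral_shift_le`). Laziness supplies
the compensating factor 1/2, and rotational invariance makes the radial weight a probability in
every direction. -/

namespace Samplers

open ProbabilityTheory

/-! ### Variance identities in `[0, ∞]`. -/

section MarkovOperator

variable {α : Type*} [MeasurableSpace α]

/-- Twice the Dirichlet form of the transition probabilities `κ` with respect to `μ`. -/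
noncomputable def dirichlet (μ : Measure α) (κ : α → Measure α) (f : α → ℝ) : ℝ≥0∞ :=
  ∫⁻ x, ∫⁻ y, ENNReal.ofReal ((f x - f y) ^ 2) ∂κ x ∂μ

lemma lintegral_sq_sub_eq {ν : Measure α} [IsProbabilityMeasure ν] {f : α → ℝ}
    (hf : MemLp f 2 ν) (c : ℝ) :
    ∫⁻ y, ENNReal.ofReal ((c - f y) ^ 2) ∂ν =
      ENNReal.ofReal (c ^ 2 - 2 * c * (∫ y, f y ∂ν) + ∫ y, f y ^ 2 ∂ν) := by
  have h1 : Integrable f ν := hf.integrable (by norm_num)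
  have h2 : Integrable (fun y => f y ^ 2) ν := hf.integrable_sq
  have h3 : (fun y => (c - f y) ^ 2) = fun y => (c ^ 2 - 2 * c * f y) + f y ^ 2 := by
    ext y; ring
  have h4 : Integrable (fun y => c ^ 2 - 2 * c * f y) ν := (integrable_const _).sub (h1.const_mul _)
  rw [← ofReal_integral_eq_lintegral_ofReal (by rw [h3]; exact h4.add h2)
    (ae_of_all _ fun y => sq_nonneg _), h3, integral_add h4 h2,
    integral_sub (integrable_const _) (h1.const_mul _), integral_const_mul]
  simp

lemma memLp_two_iff_lintegral_sq {μ : Measure α} {f : α → ℝ} (hf : AEStronglyMeasurable f μ) :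
    MemLp f 2 μ ↔ ∫⁻ x, ENNReal.ofReal (f x ^ 2) ∂μ < ∞ := by
  have h : AEStronglyMeasurable (fun x => f x ^ 2) μ := hf.pow 2
  rw [memLp_two_iff_integrable_sq hf, Integrable, and_iff_right h,
    hasFiniteIntegral_iff_ofReal (ae_of_all _ fun x => sq_nonneg _)]

lemma memLp_of_lintegral_sq_sub_lt_top {ν : Measure α} [IsFiniteMeasure ν] {f : α → ℝ}
    (hf : Measurable f) (c : ℝ) (h : ∫⁻ y, ENNReal.ofReal ((f y - c) ^ 2) ∂ν < ∞) :
    MemLp f 2 ν := by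
  have h1 : MemLp (fun y => f y - c) 2 ν :=
    (memLp_two_iff_lintegral_sq (hf.sub_const c).aestronglyMeasurable).2 h
  refine (h1.add (memLp_const c)).ae_eq (ae_of_all _ fun y => ?_)
  simp

lemma sq_integral_le_integral_sq {ν : Measure α} [IsProbabilityMeasure ν] {f : α → ℝ}
    (hf : MemLp f 2 ν) : (∫ y, f y ∂ν) ^ 2 ≤ ∫ y, f y ^ 2 ∂ν := by
  have := variance_nonneg f ν
  rw [variance_eq_sub hf] at this
  simpa using this

lemma lintegral_lintegral_sq_sub_eq {ν : Measure α} [IsProbabilityMeasure ν] {f : α → ℝ}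
    (hf : MemLp f 2 ν) :
    ∫⁻ x, ∫⁻ y, ENNReal.ofReal ((f x - f y) ^ 2) ∂ν ∂ν =
      ENNReal.ofReal (2 * (∫ y, f y ^ 2 ∂ν - (∫ y, f y ∂ν) ^ 2)) := by
  have h1 : Integrable f ν := hf.integrable (by norm_num)
  have h2 : Integrable (fun y => f y ^ 2) ν := hf.integrable_sq
  have h5 : Integrable (fun x => f x ^ 2 - 2 * f x * ∫ y, f y ∂ν) ν :=
    h2.sub ((h1.const_mul 2).mul_const _)
  have h6 : Integrable (fun x => f x ^ 2 - 2 * f x * (∫ y, f y ∂ν) + ∫ y, f y ^ 2 ∂ν) ν :=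
    h5.add (integrable_const _)
  simp_rw [lintegral_sq_sub_eq hf]
  rw [← ofReal_integral_eq_lintegral_ofReal h6 (ae_of_all _ fun x => ?_),
    integral_add h5 (integrable_const _), integral_sub h2 ((h1.const_mul 2).mul_const _),
    integral_mul_const, integral_const_mul]
  · congr 1
    simp only [integral_const, probReal_univ, one_smul]
    ring
  · show 0 ≤ f x ^ 2 - 2 * f x * (∫ y, f y ∂ν) + ∫ y, f y ^ 2 ∂ν
    nlinarith [sq_nonneg (f x - ∫ y, f y ∂ν), sq_integral_le_integral_sq hf]

/-- The mean square deviation from any constant bounds the variance. -/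
lemma lintegral_lintegral_sq_sub_le {ν : Measure α} [IsProbabilityMeasure ν] {f : α → ℝ}
    (hf : Measurable f) (c : ℝ) :
    ∫⁻ x, ∫⁻ y, ENNReal.ofReal ((f x - f y) ^ 2) ∂ν ∂ν ≤
      2 * ∫⁻ x, ENNReal.ofReal ((f x - c) ^ 2) ∂ν := by
  -- An infinite right side is trivial; a finite one forces `f ∈ L²`, where explicit formulas apply.
  by_cases h : ∫⁻ y, ENNReal.ofReal ((f y - c) ^ 2) ∂ν < ∞
  swap
  · rw [not_lt_top_iff.1 h]; simp
  have hm := memLp_of_lintegral_sq_sub_lt_top hf c h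
  simp_rw [fun x => sub_sq_comm (f x) c, lintegral_lintegral_sq_sub_eq hm, lintegral_sq_sub_eq hm]
  rw [show (2 : ℝ≥0∞) = ENNReal.ofReal 2 by simp, ← ENNReal.ofReal_mul (by norm_num)]
  apply ENNReal.ofReal_le_ofReal
  nlinarith [sq_nonneg (c - ∫ y, f y ∂ν)]

/-- Twice the variance is the mean square difference of two independent copies. No integrability is
needed: both sides are infinite when `f ∉ L²`, even though the Bochner mean may then be the default
value 0. -/
lemma two_mul_lintegral_sq_sub_integral {ν : Measure α} [IsProbabilityMeasure ν] {f : α → ℝ}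
    (hf : Measurable f) :
    2 * ∫⁻ x, ENNReal.ofReal ((f x - ∫ y, f y ∂ν) ^ 2) ∂ν =
      ∫⁻ x, ∫⁻ y, ENNReal.ofReal ((f x - f y) ^ 2) ∂ν ∂ν := by
  refine le_antisymm ?_ (lintegral_lintegral_sq_sub_le hf _)
  by_cases h : ∫⁻ x, ∫⁻ y, ENNReal.ofReal ((f x - f y) ^ 2) ∂ν ∂ν < ∞
  swap
  · rw [not_lt_top_iff.1 h]; exact le_top
  have hmeas : Measurable fun x => ∫⁻ y, ENNReal.ofReal ((f x - f y) ^ 2) ∂ν := by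
    refine Measurable.lintegral_prod_right' (f := fun p : α × α =>
      ENNReal.ofReal ((f p.1 - f p.2) ^ 2)) ?_
    fun_prop
  -- A single slice with finite deviation from the constant `f x₀` already puts `f` in `L²`.
  obtain ⟨x₀, hx₀⟩ := (ae_lt_top hmeas h.ne).exists
  have hm : MemLp f 2 ν := by
    refine memLp_of_lintegral_sq_sub_lt_top hf (f x₀) ?_
    simpa only [sub_sq_comm] using hx₀
  simp_rw [fun x => sub_sq_comm (f x) (∫ y, f y ∂ν), lintegral_lintegral_sq_sub_eq hm,
    lintegral_sq_sub_eq hm]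
  rw [show (2 : ℝ≥0∞) = ENNReal.ofReal 2 by simp, ← ENNReal.ofReal_mul (by norm_num)]
  apply ENNReal.ofReal_le_ofReal
  nlinarith

/-! ### Averaging kernels and their Dirichlet forms. -/

/-- The transition probabilities `κ` resample from `μ` conditionally on a sub-`σ`-algebra:
they leave `μ` invariant and are constant on the set they reach. -/
structure IsAveraging (μ : Measure α) (κ : Kernel α α) : Prop where
  isProb : ∀ᵐ x ∂μ, IsProbabilityMeasure (κ x)
  bind_eq : μ.bind κ = μ
  const : ∀ x, ∀ᵐ z ∂κ x, κ z = κ x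

lemma IsAveraging.lintegral_lintegral {μ : Measure α} {κ : Kernel α α} (h : IsAveraging μ κ)
    {F : α → ℝ≥0∞} (hF : Measurable F) : ∫⁻ x, ∫⁻ z, F z ∂κ x ∂μ = ∫⁻ x, F x ∂μ := by
  conv_rhs => rw [← h.bind_eq, Measure.lintegral_bind κ.aemeasurable hF.aemeasurable]

lemma measurable_lintegral_sq_sub (κ : Kernel α α) [IsSFiniteKernel κ] {f : α → ℝ}
    (hf : Measurable f) : Measurable fun x => ∫⁻ y, ENNReal.ofReal ((f x - f y) ^ 2) ∂κ x :=
  Measurable.lintegral_kernel_prod_right' (f := fun p : α × α =>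
    ENNReal.ofReal ((f p.1 - f p.2) ^ 2)) (by fun_prop)

/-- By invariance the starting point may be replaced by a fresh draw `z` from `κ x`; since `κ z = κ
x`, the form becomes an average over two independent draws from `κ x`. -/
lemma IsAveraging.dirichlet_eq_lintegral_variance {μ : Measure α} {κ : Kernel α α}
    [IsSFiniteKernel κ] (h : IsAveraging μ κ) {f : α → ℝ} (hf : Measurable f) :
    dirichlet μ κ f =
      ∫⁻ x, ∫⁻ z, ∫⁻ y, ENNReal.ofReal ((f z - f y) ^ 2) ∂κ x ∂κ x ∂μ := by
  rw [dirichlet, ← h.lintegral_lintegral (measurable_lintegral_sq_sub κ hf)]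
  refine lintegral_congr fun x => lintegral_congr_ae ?_
  filter_upwards [h.const x] with z hz
  rw [hz]

/-- Under `κ x` the function `g` is almost surely the constant `g x`, so the variance of `f` under
`κ x` is at most its mean square deviation from `g`. This is the source of both comparisons with
hybrid slice sampling as the larger operator. -/
lemma IsAveraging.dirichlet_le {μ : Measure α} {κ : Kernel α α}
    [IsSFiniteKernel κ] (h : IsAveraging μ κ) {f g : α → ℝ} (hf : Measurable f)
    (hg : Measurable g) (hgκ : ∀ x, ∀ᵐ z ∂κ x, g z = g x) :
    dirichlet μ κ f ≤ 2 * ∫⁻ x, ENNReal.ofReal ((f x - g x) ^ 2) ∂μ := by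
  have hm : Measurable fun x => ENNReal.ofReal ((f x - g x) ^ 2) := by fun_prop
  rw [h.dirichlet_eq_lintegral_variance hf, ← h.lintegral_lintegral hm,
    ← lintegral_const_mul _ hm.lintegral_kernel]
  refine lintegral_mono_ae ?_
  filter_upwards [h.isProb] with x hx
  refine (lintegral_lintegral_sq_sub_le hf (g x)).trans_eq ?_
  congr 1
  refine lintegral_congr_ae ?_
  filter_upwards [hgκ x] with z hz
  rw [hz]

lemma IsAveraging.dirichlet_eq {μ : Measure α} {κ : Kernel α α}
    [IsSFiniteKernel κ] (h : IsAveraging μ κ) {f : α → ℝ} (hf : Measurable f) :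
    dirichlet μ κ f = 2 * ∫⁻ x, ENNReal.ofReal ((f x - ∫ y, f y ∂κ x) ^ 2) ∂μ := by
  have hg : Measurable fun x => ∫ y, f y ∂κ x :=
    (hf.stronglyMeasurable.integral_kernel (κ := κ)).measurable
  have hm : Measurable fun x => ENNReal.ofReal ((f x - ∫ y, f y ∂κ x) ^ 2) := by fun_prop
  rw [h.dirichlet_eq_lintegral_variance hf, ← h.lintegral_lintegral hm,
    ← lintegral_const_mul _ hm.lintegral_kernel]
  refine lintegral_congr_ae ?_
  filter_upwards [h.isProb] with x hx
  rw [← two_mul_lintegral_sq_sub_integral hf]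
  congr 1
  refine lintegral_congr_ae ?_
  filter_upwards [h.const x] with z hz
  rw [hz]

/-! ### Operators on `L²` induced by kernels with an invariant measure. -/

variable {π : Measure α} {κ : Kernel α α}

/-- Makes the operator independent of the representative of an `L²` class. -/
lemma ae_ae_of_bind_eq (hinv : π.bind κ = π) {p : α → Prop} (h : ∀ᵐ x ∂π, p x) :
    ∀ᵐ x ∂π, ∀ᵐ y ∂κ x, p y :=
  Measure.ae_ae_of_ae_bind κ.aemeasurable (by rwa [hinv])

lemma integrable_integral_of_bind_eq (hinv : π.bind κ = π) {F : α → ℝ} (hF : Integrable F π) :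
    Integrable (fun x => ∫ y, F y ∂κ x) π ∧ ∫ x, ∫ y, F y ∂κ x ∂π = ∫ x, F x ∂π := by
  have h1 : (κ ∘ₖ Kernel.const Unit π) () = π := by
    rw [Kernel.comp_apply, Kernel.const_apply, hinv]
  have h2 : Integrable F ((κ ∘ₖ Kernel.const Unit π) ()) := by rwa [h1]
  refine ⟨by simpa using h2.integral_comp, ?_⟩
  have := Kernel.integral_comp h2
  rw [h1] at this
  simpa using this.symm

lemma ae_memLp_of_bind_eq (hinv : π.bind κ = π) {f : α → ℝ} (hf : MemLp f 2 π) :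
    ∀ᵐ x ∂π, MemLp f 2 (κ x) := by
  have h2 : ∀ᵐ x ∂π, Integrable (fun y => f y ^ 2) (κ x) := by
    have := hf.integrable_sq
    rw [← hinv] at this
    exact ((Measure.integrable_comp_iff this.1).1 this).1
  have hm : AEMeasurable f (π.bind κ) := by rw [hinv]; exact hf.1.aemeasurable
  filter_upwards [h2, AEMeasurable.ae_of_bind κ.aemeasurable hm] with x hx hx'
  exact (memLp_two_iff_integrable_sq hx'.aestronglyMeasurable).2 hx

/-- Contraction on `L²`: Jensen's inequality for each `κ x`, then invariance. -/
lemma memLp_integral_of_bind_eq [IsFiniteMeasure π]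
    (hp : ∀ᵐ x ∂π, IsProbabilityMeasure (κ x)) (hinv : π.bind κ = π) {f : α → ℝ}
    (hf : MemLp f 2 π) :
    MemLp (fun x => ∫ y, f y ∂κ x) 2 π ∧ ∫ x, (∫ y, f y ∂κ x) ^ 2 ∂π ≤ ∫ x, f x ^ 2 ∂π := by
  obtain ⟨h1, h2⟩ := integrable_integral_of_bind_eq hinv hf.integrable_sq
  have h3 : AEStronglyMeasurable (fun x => ∫ y, f y ∂κ x) π :=
    (integrable_integral_of_bind_eq hinv (hf.integrable (by norm_num))).1.1
  have h4 : ∀ᵐ x ∂π, (∫ y, f y ∂κ x) ^ 2 ≤ ∫ y, f y ^ 2 ∂κ x := by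
    filter_upwards [hp, ae_memLp_of_bind_eq hinv hf] with x hx hx'
    exact sq_integral_le_integral_sq hx'
  have h5 : Integrable (fun x => (∫ y, f y ∂κ x) ^ 2) π := by
    refine h1.mono (h3.pow 2) ?_
    filter_upwards [h4] with x hx
    rw [Real.norm_of_nonneg (sq_nonneg _)]
    exact hx.trans (le_abs_self _)
  exact ⟨(memLp_two_iff_integrable_sq h3).2 h5, h2 ▸ integral_mono_ae h5 h1 h4⟩

lemma norm_sq_Lp_two (f : Lp ℝ 2 π) : ‖f‖ ^ 2 = ∫ x, f x ^ 2 ∂π := by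
  rw [← real_inner_self_eq_norm_sq, L2.inner_def]
  simp [sq]

/-- Transition probabilities with an invariant distribution induce a Markov operator. -/
theorem exists_isMarkovOperator [IsFiniteMeasure π]
    (hp : ∀ᵐ x ∂π, IsProbabilityMeasure (κ x)) (hinv : π.bind κ = π) :
    ∃ P : Lp ℝ 2 π →L[ℝ] Lp ℝ 2 π, IsMarkovOperator π κ P := by
  have hI : ∀ f : Lp ℝ 2 π, ∀ᵐ x ∂π, Integrable f (κ x) := fun f => by
    filter_upwards [hp, ae_memLp_of_bind_eq hinv (Lp.memLp f)] with x hx hx'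
    exact hx'.integrable (by norm_num)
  let T : Lp ℝ 2 π → Lp ℝ 2 π := fun f => (memLp_integral_of_bind_eq hp hinv (Lp.memLp f)).1.toLp _
  have hT : ∀ f : Lp ℝ 2 π, T f =ᵐ[π] fun x => ∫ y, f y ∂κ x := fun f => MemLp.coeFn_toLp _
  let L : Lp ℝ 2 π →ₗ[ℝ] Lp ℝ 2 π :=
    { toFun := T
      map_add' := fun f g => by
        apply Lp.ext
        filter_upwards [hT (f + g), hT f, hT g, Lp.coeFn_add (T f) (T g), hI f, hI g,
          ae_ae_of_bind_eq hinv (Lp.coeFn_add f g)] with x h1 h2 h3 h4 h5 h6 h7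
        rw [h1, h4, Pi.add_apply, h2, h3, integral_congr_ae h7, ← integral_add h5 h6]
        rfl
      map_smul' := fun c f => by
        apply Lp.ext
        filter_upwards [hT (c • f), hT f, Lp.coeFn_smul c (T f),
          ae_ae_of_bind_eq hinv (Lp.coeFn_smul c f)] with x h1 h2 h3 h4
        rw [h1, RingHom.id_apply, h3, Pi.smul_apply, h2, integral_congr_ae h4, ← integral_smul]
        rfl }
  have hL : ∀ f, ‖L f‖ ≤ 1 * ‖f‖ := fun f => by
    rw [one_mul]
    refine le_of_sq_le_sq ?_ (norm_nonneg _)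
    rw [norm_sq_Lp_two, norm_sq_Lp_two]
    refine le_trans (le_of_eq (integral_congr_ae ?_))
      (memLp_integral_of_bind_eq hp hinv (Lp.memLp f)).2
    filter_upwards [hT f] with x hx
    show (T f x) ^ 2 = _
    rw [hx]
  refine ⟨L.mkContinuous 1 hL, hp, fun f hf => ?_⟩
  filter_upwards [hp, ae_memLp_of_bind_eq hinv hf, hT (hf.toLp f),
    ae_ae_of_bind_eq hinv hf.coeFn_toLp] with x h1 h2 h3 h4
  refine ⟨h2.integrable (by norm_num), ?_⟩
  show T (hf.toLp f) x = _
  rw [h3, integral_congr_ae h4]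

/-- Expand the square: `f(x)²` and, by invariance, `f(y)²` each contribute `‖f‖²`, and the cross
term is the inner product. Reversibility plays no role. The nonnegativity part is what later allows
`ENNReal.ofReal`, which truncates negative numbers, to be removed. -/
lemma IsMarkovOperator.dirichlet_eq [IsFiniteMeasure π] (hinv : π.bind κ = π)
    {P : Lp ℝ 2 π →L[ℝ] Lp ℝ 2 π} (hP : IsMarkovOperator π κ P) (f : Lp ℝ 2 π) :
    0 ≤ 2 * (‖f‖ ^ 2 - inner ℝ (P f) f) ∧
      dirichlet π κ f = ENNReal.ofReal (2 * (‖f‖ ^ 2 - inner ℝ (P f) f)) := by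
  have hf := Lp.memLp f
  obtain ⟨h1, h2⟩ := integrable_integral_of_bind_eq hinv hf.integrable_sq
  have h3 : Integrable (fun x => P f x * f x) π := by
    simpa [mul_comm] using L2.integrable_inner (𝕜 := ℝ) (P f) f
  have h4 : inner ℝ (P f) f = ∫ x, P f x * f x ∂π := by
    rw [L2.inner_def]
    simp [mul_comm]
  have h5 : Integrable (fun x => f x ^ 2 - 2 * (P f x * f x)) π :=
    hf.integrable_sq.sub (h3.const_mul 2)
  have h6 : Integrable (fun x => f x ^ 2 - 2 * (P f x * f x) + ∫ y, f y ^ 2 ∂κ x) π := h5.add h1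
  have h7 : ∫ x, (f x ^ 2 - 2 * (P f x * f x) + ∫ y, f y ^ 2 ∂κ x) ∂π =
      2 * (‖f‖ ^ 2 - inner ℝ (P f) f) := by
    rw [integral_add h5 h1, integral_sub hf.integrable_sq (h3.const_mul 2), integral_const_mul, h2,
      h4, norm_sq_Lp_two]
    ring
  have h8 : ∀ᵐ x ∂π, P f x = ∫ y, f y ∂κ x := by
    have := hP.apply_ae f hf
    rw [Lp.toLp_coeFn] at this
    exact this.mono fun x hx => hx.2
  have h9 : ∀ᵐ x ∂π, 0 ≤ f x ^ 2 - 2 * (P f x * f x) + ∫ y, f y ^ 2 ∂κ x := by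
    filter_upwards [hP.isProb, ae_memLp_of_bind_eq hinv hf, h8] with x hp hx hx'
    rw [hx']
    nlinarith [sq_nonneg (f x - ∫ y, f y ∂κ x), sq_integral_le_integral_sq hx]
  rw [← h7]
  refine ⟨integral_nonneg_of_ae h9, ?_⟩
  rw [ofReal_integral_eq_lintegral_ofReal h6 h9, dirichlet]
  refine lintegral_congr_ae ?_
  filter_upwards [hP.isProb, ae_memLp_of_bind_eq hinv hf, h8] with x hp hx hx'
  rw [lintegral_sq_sub_eq hx, hx']
  congr 1
  ring

/-- Smaller Dirichlet forms belong to larger operators in the covariance ordering. -/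
theorem covGE_of_dirichlet_le [IsFiniteMeasure π] {κ₁ κ₂ : Kernel α α}
    (h₁ : π.bind κ₁ = π) (h₂ : π.bind κ₂ = π) {P₁ P₂ : Lp ℝ 2 π →L[ℝ] Lp ℝ 2 π}
    (hP₁ : IsMarkovOperator π κ₁ P₁) (hP₂ : IsMarkovOperator π κ₂ P₂)
    (h : ∀ f : α → ℝ, Measurable f → dirichlet π κ₁ f ≤ dirichlet π κ₂ f) : CovGE P₁ P₂ := by
  intro f
  have := h f (Lp.stronglyMeasurable f).measurable
  obtain ⟨h3, h4⟩ := hP₂.dirichlet_eq h₂ f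
  rw [(hP₁.dirichlet_eq h₁ f).2, h4, ENNReal.ofReal_le_ofReal_iff h3] at this
  linarith

end MarkovOperator

/-! ### Normalized measures. -/

section Normalized

variable {α : Type*} [MeasurableSpace α]

lemma lintegral_normalized (μ : Measure α) (F : α → ℝ≥0∞) :
    ∫⁻ x, F x ∂normalized μ = (μ univ)⁻¹ * ∫⁻ x, F x ∂μ := by
  rw [normalized, lintegral_smul_measure, smul_eq_mul]

lemma normalized_apply (μ : Measure α) (s : Set α) : normalized μ s = (μ univ)⁻¹ * μ s := by
  rw [normalized, Measure.smul_apply, smul_eq_mul]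

/-- The conventions of `ℝ≥0∞` turn measures of total mass 0 or ∞ into the zero measure. The samplers
are therefore sub-Markov at every point, with no exceptional set to remove. -/
lemma normalized_univ_le_one (μ : Measure α) : normalized μ univ ≤ 1 := by
  rw [normalized_apply]
  exact ENNReal.inv_mul_le_one _

instance (μ : Measure α) : IsFiniteMeasure (normalized μ) :=
  ⟨(normalized_univ_le_one μ).trans_lt ENNReal.one_lt_top⟩

lemma isProbabilityMeasure_normalized {μ : Measure α} (h0 : μ univ ≠ 0) (h1 : μ univ ≠ ∞) :
    IsProbabilityMeasure (normalized μ) :=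
  ⟨by rw [normalized_apply, ENNReal.inv_mul_cancel h0 h1]⟩

lemma ae_normalized {μ : Measure α} {p : α → Prop} (h : ∀ᵐ x ∂μ, p x) :
    ∀ᵐ x ∂normalized μ, p x :=
  Measure.ae_smul_measure h _

lemma measurable_normalized {β : Type*} [MeasurableSpace β] {μ : β → Measure α}
    (hμ : Measurable μ) : Measurable fun b => normalized (μ b) := by
  refine Measure.measurable_of_measurable_coe _ fun s hs => ?_
  simp_rw [normalized_apply]
  exact ((Measure.measurable_coe MeasurableSet.univ).comp hμ).inv.mul
    ((Measure.measurable_coe hs).comp hμ)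

end Normalized

variable {d : ℕ}

/-- The Euclidean space of dimension `d`. -/
abbrev Space (d : ℕ) : Type := EuclideanSpace ℝ (Fin d)

/-- The unit sphere of directions. -/
abbrev Direction (d : ℕ) : Type := Metric.sphere (0 : Space d) 1

lemma inner_direction_self (θ : Direction d) : inner ℝ (θ : Space d) (θ : Space d) = 1 := by
  rw [real_inner_self_eq_norm_sq, norm_eq_of_mem_sphere, one_pow]

/-! ### Lebesgue measure on lines. -/

section Line

variable (x : Space d) (θ : Direction d)

lemma lintegral_lineMeasure {F : Space d → ℝ≥0∞} (hF : Measurable F) :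
    ∫⁻ z, F z ∂lineMeasure x θ = ∫⁻ s : ℝ, F (x + s • (θ : Space d)) := by
  rw [lineMeasure, lintegral_map hF (by fun_prop)]

lemma lineMeasure_add_smul (s : ℝ) :
    lineMeasure (x + s • (θ : Space d)) θ = lineMeasure x θ := by
  refine Measure.ext_of_lintegral _ fun F hF => ?_
  rw [lintegral_lineMeasure _ _ hF, lintegral_lineMeasure _ _ hF,
    ← lintegral_add_left_eq_self (fun r : ℝ => F (x + r • (θ : Space d))) s]
  simp only [add_smul, add_assoc]

/-- The line is the set where `z` equals its orthogonal projection onto it, an equality of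
measurable functions. -/
lemma measurableSet_line : MeasurableSet {z : Space d | ∃ s : ℝ, z = x + s • (θ : Space d)} := by
  have : {z : Space d | ∃ s : ℝ, z = x + s • (θ : Space d)} =
      {z | z = x + (inner ℝ (z - x) (θ : Space d)) • (θ : Space d)} := by
    ext z
    refine ⟨?_, fun h => ⟨_, h⟩⟩
    rintro ⟨s, rfl⟩
    simp [inner_smul_left]
  rw [this]
  exact measurableSet_eq_fun (by fun_prop) (by fun_prop)

lemma ae_lineMeasure : ∀ᵐ z ∂lineMeasure x θ, ∃ s : ℝ, z = x + s • (θ : Space d) := by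
  rw [lineMeasure, ae_map_iff (by fun_prop) (measurableSet_line x θ)]
  exact ae_of_all _ fun s => ⟨s, rfl⟩

lemma restrict_chord_lineMeasure {G : Set (Space d)} :
    (lineMeasure x θ).restrict (chord G x θ) = (lineMeasure x θ).restrict G := by
  refine Measure.restrict_congr_set ?_
  filter_upwards [ae_lineMeasure x θ] with z hz
  exact propext ⟨fun h => h.1, fun h => ⟨h, hz⟩⟩

end Line

/-- The distribution proportional to `h` on the line through `x` in direction `θ`. -/
noncomputable def chordDist (h : Space d → ℝ≥0∞) (x : Space d) (θ : Direction d) :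
    Measure (Space d) :=
  normalized ((lineMeasure x θ).withDensity h)

instance (h : Space d → ℝ≥0∞) (x : Space d) (θ : Direction d) :
    IsFiniteMeasure (chordDist h x θ) := by
  unfold chordDist; infer_instance

/-- The integral of `h` along the line through `x` in direction `θ`. -/
noncomputable def chordMass (h : Space d → ℝ≥0∞) (x : Space d) (θ : Direction d) : ℝ≥0∞ :=
  ∫⁻ s : ℝ, h (x + s • (θ : Space d))

/-! ### Resampling along the lines of one direction. -/

section Chord

variable {h : Space d → ℝ≥0∞} (hh : Measurable h) (θ : Direction d)

include hh in
lemma withDensity_lineMeasure_univ (x : Space d) :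
    ((lineMeasure x θ).withDensity h) univ = chordMass h x θ := by
  rw [withDensity_apply _ MeasurableSet.univ, Measure.restrict_univ, lintegral_lineMeasure _ _ hh,
    chordMass]

include hh in
lemma lintegral_chordDist (x : Space d) {F : Space d → ℝ≥0∞} (hF : Measurable F) :
    ∫⁻ z, F z ∂chordDist h x θ = (chordMass h x θ)⁻¹ *
      ∫⁻ s : ℝ, h (x + s • (θ : Space d)) * F (x + s • (θ : Space d)) := by
  rw [chordDist, lintegral_normalized, withDensity_lineMeasure_univ hh,
    lintegral_withDensity_eq_lintegral_mul _ hh hF, lintegral_lineMeasure _ _ (hh.mul hF)]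
  rfl

lemma chordDist_add_smul (x : Space d) (s : ℝ) :
    chordDist h (x + s • (θ : Space d)) θ = chordDist h x θ := by
  rw [chordDist, lineMeasure_add_smul, chordDist]

include hh in
lemma chordMass_add_smul (x : Space d) (s : ℝ) :
    chordMass h (x + s • (θ : Space d)) θ = chordMass h x θ := by
  rw [← withDensity_lineMeasure_univ hh, lineMeasure_add_smul, withDensity_lineMeasure_univ hh]

lemma ae_chordDist (x : Space d) : ∀ᵐ z ∂chordDist h x θ, ∃ s : ℝ, z = x + s • (θ : Space d) :=
  ae_normalized ((withDensity_absolutelyContinuous _ _).ae_le (ae_lineMeasure x θ))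

lemma measurable_chordMass {β : Type*} [MeasurableSpace β] {h : β → Space d → ℝ≥0∞}
    (hh : Measurable (Function.uncurry h)) {x : β → Space d} (hx : Measurable x)
    {θ : β → Direction d} (hθ : Measurable θ) :
    Measurable fun b => chordMass (h b) (x b) (θ b) := by
  unfold chordMass
  refine Measurable.lintegral_prod_right' (f := fun p : β × ℝ =>
    Function.uncurry h (p.1, x p.1 + p.2 • (θ p.1 : Space d))) ?_
  fun_prop

lemma measurable_chordDist {β : Type*} [MeasurableSpace β] {h : β → Space d → ℝ≥0∞}
    (hh : Measurable (Function.uncurry h)) {x : β → Space d} (hx : Measurable x)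
    {θ : β → Direction d} (hθ : Measurable θ) :
    Measurable fun b => chordDist (h b) (x b) (θ b) := by
  refine measurable_normalized (Measure.measurable_of_measurable_coe _ fun A hA => ?_)
  have h1 : ∀ b, (lineMeasure (x b) (θ b)).withDensity (h b) A =
      chordMass (A.indicator (h b)) (x b) (θ b) := fun b => by
    have hb : Measurable (h b) := hh.comp measurable_prodMk_left
    rw [withDensity_apply _ hA, ← lintegral_indicator hA,
      lintegral_lineMeasure _ _ (hb.indicator hA), chordMass]
  simp_rw [h1]
  refine measurable_chordMass ?_ hx hθ
  exact hh.indicator (measurable_snd hA)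

include hh in
lemma measurable_chordDist_left : Measurable fun x => chordDist h x θ :=
  measurable_chordDist (h := fun _ => h) (hh.comp measurable_snd) measurable_id measurable_const

include hh in
lemma measurable_chordMass_left : Measurable fun x => chordMass h x θ :=
  measurable_chordMass (h := fun _ => h) (hh.comp measurable_snd) measurable_id measurable_const

/-- The transition kernel `x ↦ chordDist h x θ`. -/
noncomputable def chordKernel (h : Space d → ℝ≥0∞) (hh : Measurable h) (θ : Direction d) :
    Kernel (Space d) (Space d) :=
  ⟨fun x => chordDist h x θ, measurable_chordDist_left hh θ⟩

lemma chordKernel_apply (x : Space d) : chordKernel h hh θ x = chordDist h x θ := rfl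

instance : IsFiniteKernel (chordKernel h hh θ) :=
  ⟨1, ENNReal.one_lt_top, fun _ => normalized_univ_le_one _⟩

/-- Moving along lines in a fixed direction is reversible with respect to Lebesgue measure. -/
lemma lintegral_lintegral_line_swap {Φ : Space d → Space d → ℝ≥0∞}
    (hΦ : Measurable (Function.uncurry Φ)) (v : Space d) :
    ∫⁻ x, ∫⁻ s : ℝ, Φ x (x + s • v) = ∫⁻ x, ∫⁻ s : ℝ, Φ (x + s • v) x := by
  have h1 : Measurable fun p : Space d × ℝ => Φ p.1 (p.1 + p.2 • v) :=
    hΦ.comp (f := fun p : Space d × ℝ => (p.1, p.1 + p.2 • v)) (by fun_prop)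
  have h2 : Measurable fun p : Space d × ℝ => Φ (p.1 + p.2 • v) p.1 :=
    hΦ.comp (f := fun p : Space d × ℝ => (p.1 + p.2 • v, p.1)) (by fun_prop)
  rw [lintegral_lintegral_swap h1.aemeasurable]
  conv_rhs => rw [lintegral_lintegral_swap h2.aemeasurable]
  -- With the integrals exchanged, reflect `s ↦ -s` and translate `x` by `s • v`.
  rw [← (Measure.measurePreserving_neg (volume : Measure ℝ)).lintegral_comp
      (Measurable.lintegral_prod_left' h2)]
  refine lintegral_congr fun s => ?_
  rw [← lintegral_add_right_eq_self (fun x => Φ (x + (-s) • v) x) (s • v)]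
  simp

include hh in
-- The set of points with zero chord mass is a union of lines on each of which `h` integrates to
-- zero. Swapping the two ends of a move along the line turns this into `(∫ h over that set) · ∞ =
-- 0`.
lemma ae_chordMass_ne_zero :
    ∀ᵐ x ∂(volume : Measure (Space d)).withDensity h, chordMass h x θ ≠ 0 := by
  have hm : MeasurableSet {x | chordMass h x θ = 0} :=
    measurable_chordMass_left hh θ (measurableSet_singleton 0)
  have h0 : ∫⁻ x, ∫⁻ _ : ℝ, {x | chordMass h x θ = 0}.indicator h x = 0 := by
    rw [← lintegral_lintegral_line_swap (Φ := fun _ y => {x | chordMass h x θ = 0}.indicator h y)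
      ((hh.indicator hm).comp measurable_snd) (θ : Space d)]
    refine lintegral_eq_zero_of_ae_eq_zero (ae_of_all _ fun x => ?_)
    by_cases hx : chordMass h x θ = 0
    · refine le_antisymm ?_ zero_le
      refine (lintegral_mono fun s => ?_).trans_eq hx
      exact indicator_le_self _ _ _
    · simp [indicator, chordMass_add_smul hh, hx]
  rw [ae_iff, withDensity_apply _ (by simpa using hm)]
  simp only [not_not]
  rw [← lintegral_indicator hm]
  simp only [lintegral_const, Real.volume_univ] at h0
  rw [lintegral_mul_const _ (hh.indicator hm)] at h0
  simpa using h0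

include hh in
-- Each line in direction `θ` meets the slab `|⟨x, θ⟩| ≤ n` in a segment of length `2n`, so the
-- chord mass has integral `2n ∫ h < ∞` over the slab. The slabs exhaust the space.
lemma ae_chordMass_lt_top (hfin : ∫⁻ x, h x ≠ ∞) :
    ∀ᵐ x : Space d, chordMass h x θ < ∞ := by
  have hT : ∀ n : ℕ, MeasurableSet {x : Space d | |inner ℝ x (θ : Space d)| ≤ n} := fun n =>
    measurableSet_le (by fun_prop) measurable_const
  have key : ∀ n : ℕ, ∀ᵐ x : Space d, |inner ℝ x (θ : Space d)| ≤ n → chordMass h x θ < ∞ := by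
    intro n
    set T := {x : Space d | |inner ℝ x (θ : Space d)| ≤ n} with hTdef
    have h1 : ∫⁻ x in T, chordMass h x θ < ∞ := by
      rw [← lintegral_indicator (hT n)]
      have h2 : ∀ x, T.indicator (fun x => chordMass h x θ) x =
          ∫⁻ s : ℝ, T.indicator 1 x * h (x + s • (θ : Space d)) := fun x => by
        by_cases hx : x ∈ T
        · simp [hx, chordMass]
        · simp [hx]
      have h3 : ∀ x, ∫⁻ s : ℝ, T.indicator (1 : Space d → ℝ≥0∞) (x + s • (θ : Space d)) * h x =
          ENNReal.ofReal (2 * n) * h x := fun x => by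
        have hTm : MeasurableSet ((fun s : ℝ => x + s • (θ : Space d)) ⁻¹' T) :=
          (hT n).preimage (by fun_prop)
        have h4 : (fun s : ℝ => T.indicator (1 : Space d → ℝ≥0∞) (x + s • (θ : Space d))) =
            ((fun s : ℝ => x + s • (θ : Space d)) ⁻¹' T).indicator 1 := rfl
        have h5 : ((fun s : ℝ => x + s • (θ : Space d)) ⁻¹' T) =
            Icc (-n - inner ℝ x (θ : Space d)) (n - inner ℝ x (θ : Space d)) := by
          ext s
          simp only [hTdef, mem_preimage, mem_ofPred_eq, inner_add_left, inner_smul_left,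
            inner_direction_self, mem_Icc, abs_le]
          simp only [conj_trivial, mul_one]
          constructor <;> rintro ⟨a, b⟩ <;> constructor <;> linarith
        rw [lintegral_mul_const'' _ (by rw [h4]; exact (measurable_one.indicator hTm).aemeasurable),
          h4, lintegral_indicator_one hTm, h5, Real.volume_Icc]
        congr 2
        ring
      rw [lintegral_congr h2, lintegral_lintegral_line_swap (Φ := fun x y => T.indicator 1 x * h y)
        (((measurable_one.indicator (hT n)).comp measurable_fst).mul (hh.comp measurable_snd)),
        lintegral_congr h3, lintegral_const_mul _ hh]
      exact ENNReal.mul_lt_top ENNReal.ofReal_lt_top hfin.lt_top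
    have := ae_lt_top (measurable_chordMass_left hh θ) h1.ne
    rwa [ae_restrict_iff' (hT n)] at this
  filter_upwards [ae_all_iff.2 key] with x hx
  obtain ⟨n, hn⟩ := exists_nat_ge |inner ℝ x (θ : Space d)|
  exact hx n hn

include hh in
lemma ae_chordMass (hfin : ∫⁻ x, h x ≠ ∞) :
    ∀ᵐ x ∂(volume : Measure (Space d)).withDensity h,
      chordMass h x θ ≠ 0 ∧ chordMass h x θ ≠ ∞ := by
  filter_upwards [ae_chordMass_ne_zero hh θ,
    (withDensity_absolutelyContinuous _ _).ae_le (ae_chordMass_lt_top hh θ hfin)] with x h1 h2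
  exact ⟨h1, h2.ne⟩

/-- Resampling along lines in direction `θ` with density `h` averages with respect to the
measure with density `h`. -/
theorem isAveraging_chordKernel (hfin : ∫⁻ x, h x ≠ ∞) :
    IsAveraging ((volume : Measure (Space d)).withDensity h) (chordKernel h hh θ) where
  isProb := by
    filter_upwards [ae_chordMass hh θ hfin] with x hx
    rw [chordKernel_apply, chordDist]
    refine isProbabilityMeasure_normalized ?_ ?_ <;> rw [withDensity_lineMeasure_univ hh]
    exacts [hx.1, hx.2]
  const x := by
    filter_upwards [ae_chordDist (h := h) θ x] with z hz
    obtain ⟨s, rfl⟩ := hz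
    exact chordDist_add_smul θ x s
  bind_eq := by
    refine Measure.ext_of_lintegral _ fun F hF => ?_
    have hl := measurable_chordMass_left hh θ
    rw [Measure.lintegral_bind (Kernel.aemeasurable _) hF.aemeasurable,
      lintegral_withDensity_eq_lintegral_mul _ hh hF.lintegral_kernel]
    have h1 : ∀ x, (h * fun x => ∫⁻ z, F z ∂chordKernel h hh θ x) x =
        ∫⁻ s : ℝ, h x * (chordMass h x θ)⁻¹ *
          (h (x + s • (θ : Space d)) * F (x + s • (θ : Space d))) := fun x => by
      rw [Pi.mul_apply, chordKernel_apply, lintegral_chordDist hh θ x hF,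
        lintegral_const_mul _ (by fun_prop), mul_assoc]
    simp_rw [h1]
    -- After the swap the factor in front is `mass⁻¹ · mass` of the common line, which is 1 because
    -- masses 0 and ∞ are negligible for the measure with density `h`.
    rw [lintegral_lintegral_line_swap
      (Φ := fun x y => h x * (chordMass h x θ)⁻¹ * (h y * F y)) (by fun_prop)]
    have h2 : ∀ x, ∫⁻ s : ℝ, h (x + s • (θ : Space d)) *
        (chordMass h (x + s • (θ : Space d)) θ)⁻¹ * (h x * F x) =
        h x * ((chordMass h x θ)⁻¹ * chordMass h x θ * F x) := fun x => by
      simp_rw [chordMass_add_smul hh, mul_assoc]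
      rw [lintegral_mul_const _ (by fun_prop), ← chordMass]
      ring
    simp_rw [h2]
    have h3 : Measurable fun x => (chordMass h x θ)⁻¹ * chordMass h x θ * F x := by fun_prop
    have h4 := lintegral_withDensity_eq_lintegral_mul (volume : Measure (Space d)) hh h3
    simp only [Pi.mul_apply] at h4
    rw [← h4]
    refine lintegral_congr_ae ?_
    filter_upwards [ae_chordMass hh θ hfin] with x hx
    rw [ENNReal.inv_mul_cancel hx.1 hx.2, one_mul]

end Chord

/-! ### Measurability and total mass of mixtures. -/

section Kernel

variable {α β γ : Type*} [MeasurableSpace α] [MeasurableSpace β] [MeasurableSpace γ]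

lemma measurable_bind_kernel (κ : Kernel α β) [IsSFiniteKernel κ] {g : α → β → Measure γ}
    (hg : Measurable (Function.uncurry g)) : Measurable fun a => (κ a).bind (g a) := by
  refine Measure.measurable_of_measurable_coe _ fun s hs => ?_
  have h1 : ∀ a, (κ a).bind (g a) s = ∫⁻ b, g a b s ∂κ a := fun a =>
    Measure.bind_apply hs (hg.comp measurable_prodMk_left).aemeasurable
  simp_rw [h1]
  exact Measurable.lintegral_kernel_prod_right ((Measure.measurable_coe hs).comp hg)

lemma bind_univ_le_one {μ : Measure β} (hμ : μ univ ≤ 1) {g : β → Measure γ}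
    (hg : ∀ b, g b univ ≤ 1) : μ.bind g univ ≤ 1 := by
  refine (Measure.bind_apply_le g MeasurableSet.univ).trans ((lintegral_mono hg).trans ?_)
  simpa using hμ

/-- A kernel of mass at most one that preserves total mass on average cannot lose mass on a set of
positive measure. -/
lemma ae_isProbabilityMeasure_of_bind_eq {π : Measure α} [IsFiniteMeasure π] {κ : Kernel α α}
    (hκ : ∀ x, κ x univ ≤ 1) (hinv : π.bind κ = π) : ∀ᵐ x ∂π, IsProbabilityMeasure (κ x) := by
  have h1 : ∫⁻ x, κ x univ ∂π = ∫⁻ _, 1 ∂π := by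
    rw [← Measure.bind_apply MeasurableSet.univ κ.aemeasurable, hinv]
    simp
  have h2 := ae_eq_of_ae_le_of_lintegral_le (ae_of_all π hκ) (by rw [h1]; simp)
    aemeasurable_const h1.ge
  filter_upwards [h2] with x hx
  exact ⟨hx⟩

lemma measurable_lintegral_of_isFinite {μ : β → Measure γ} (hμ : Measurable μ)
    (h1 : ∀ b, μ b univ ≤ 1) {F : β → γ → ℝ≥0∞} (hF : Measurable (Function.uncurry F)) :
    Measurable fun b => ∫⁻ y, F b y ∂μ b := by
  let κ : Kernel β γ := ⟨μ, hμ⟩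
  have : IsFiniteKernel κ := ⟨1, ENNReal.one_lt_top, h1⟩
  exact Measurable.lintegral_kernel_prod_right (κ := κ) hF

end Kernel

/-! ### The target measure and its level sets. -/

/-- Measurability, positivity and integrability of an unnormalized density `ρ` on `K`. -/
structure IsTargetDensity (K : Set (Space d)) (ρ : Space d → ℝ) : Prop where
  measurableSet : MeasurableSet K
  volume_ne_zero : volume K ≠ 0
  measurable : Measurable ρ
  pos : ∀ x ∈ K, 0 < ρ x
  integrableOn : IntegrableOn ρ K

/-- The function `ρ`, extended by zero outside of `K`. -/
noncomputable def density (K : Set (Space d)) (ρ : Space d → ℝ) : Space d → ℝ≥0∞ :=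
  K.indicator fun x => ENNReal.ofReal (ρ x)

/-- The indicator function of the level set at height `t`. -/
noncomputable def levelDensity (K : Set (Space d)) (ρ : Space d → ℝ) (t : ℝ) : Space d → ℝ≥0∞ :=
  (levelSet K ρ t).indicator 1

/-- The unnormalized target distribution. -/
noncomputable def mass (K : Set (Space d)) (ρ : Space d → ℝ) : Measure (Space d) :=
  volume.withDensity (density K ρ)

/-- Lebesgue measure on the level set at height `t`. -/
noncomputable def levelMass (K : Set (Space d)) (ρ : Space d → ℝ) (t : ℝ) : Measure (Space d) :=
  volume.withDensity (levelDensity K ρ t)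

instance (K : Set (Space d)) (ρ : Space d → ℝ) : SFinite (mass K ρ) := by
  unfold mass; infer_instance

instance (K : Set (Space d)) (ρ : Space d → ℝ) (t : ℝ) : SFinite (levelMass K ρ t) := by
  unfold levelMass; infer_instance

/-- The uniform distribution on `(0, ρ(x))`. -/
noncomputable def heightDist (ρ : Space d → ℝ) (x : Space d) : Measure ℝ :=
  normalized (volume.restrict (Ioo 0 (ρ x)))

instance (ρ : Space d → ℝ) (x : Space d) : IsFiniteMeasure (heightDist ρ x) := by
  unfold heightDist; infer_instance

instance : IsFiniteMeasure (sphereUniform d) := by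
  unfold sphereUniform; infer_instance

/-- In dimension 0 the sphere is empty and `sphereUniform` is the zero measure. -/
lemma isProbabilityMeasure_sphereUniform (hd : 0 < d) :
    IsProbabilityMeasure (sphereUniform d) := by
  have : NeZero d := ⟨hd.ne'⟩
  refine isProbabilityMeasure_normalized ?_ (measure_ne_top _ _)
  rw [Ne, Measure.measure_univ_eq_zero]
  exact Measure.toSphere_ne_zero _

namespace IsTargetDensity

variable {K : Set (Space d)} {ρ : Space d → ℝ} (hT : IsTargetDensity K ρ)

include hT

lemma measurable_density : Measurable (density K ρ) :=
  hT.measurable.ennreal_ofReal.indicator hT.measurableSet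

lemma measurableSet_levelSet (t : ℝ) : MeasurableSet (levelSet K ρ t) :=
  hT.measurableSet.inter (measurableSet_lt measurable_const hT.measurable)

lemma measurable_uncurry_levelDensity :
    Measurable (Function.uncurry (levelDensity K ρ)) := by
  have h : MeasurableSet {p : ℝ × Space d | p.2 ∈ levelSet K ρ p.1} :=
    (measurable_snd hT.measurableSet).inter
      (measurableSet_lt measurable_fst (hT.measurable.comp measurable_snd))
  exact (measurable_one (α := ℝ≥0∞)).indicator h

lemma measurable_levelDensity (t : ℝ) : Measurable (levelDensity K ρ t) :=
  measurable_one.indicator (hT.measurableSet_levelSet t)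

lemma levelMass_eq (t : ℝ) : levelMass K ρ t = volume.restrict (levelSet K ρ t) :=
  withDensity_indicator_one (hT.measurableSet_levelSet t)

lemma lintegral_density_ne_top : ∫⁻ x, density K ρ x ≠ ∞ := by
  unfold density
  rw [lintegral_indicator hT.measurableSet]
  exact hT.integrableOn.lintegral_lt_top.ne

omit hT in
lemma mass_univ : mass K ρ univ = ∫⁻ x, density K ρ x := by
  rw [mass, withDensity_apply _ MeasurableSet.univ, Measure.restrict_univ]

lemma mass_univ_ne_zero : mass K ρ univ ≠ 0 := by
  rw [mass_univ, Ne, lintegral_eq_zero_iff hT.measurable_density]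
  intro h
  refine hT.volume_ne_zero (measure_mono_null (fun x hx => ?_) h)
  show ¬ density K ρ x = 0
  simpa [density, hx] using hT.pos x hx

lemma mass_univ_ne_top : mass K ρ univ ≠ ∞ := by
  rw [mass_univ]
  exact hT.lintegral_density_ne_top

lemma target_eq : target K ρ = normalized (mass K ρ) := by
  rw [target, mass, density, withDensity_indicator hT.measurableSet]

lemma isProbabilityMeasure_target : IsProbabilityMeasure (target K ρ) := by
  rw [hT.target_eq]
  exact isProbabilityMeasure_normalized hT.mass_univ_ne_zero hT.mass_univ_ne_top

lemma dirichlet_target (κ : Space d → Measure (Space d)) (f : Space d → ℝ) :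
    dirichlet (target K ρ) κ f = (mass K ρ univ)⁻¹ * dirichlet (mass K ρ) κ f := by
  rw [hT.target_eq, dirichlet, lintegral_normalized, dirichlet]

lemma bind_target_eq {κ : Space d → Measure (Space d)} (h : (mass K ρ).bind κ = mass K ρ) :
    (target K ρ).bind κ = target K ρ := by
  rw [hT.target_eq, normalized, Measure.bind_smul, h]

/-- Markov's inequality: `t · vol(K(t)) ≤ ∫ ρ`. -/
lemma lintegral_levelDensity_ne_top {t : ℝ} (ht : 0 < t) :
    ∫⁻ x, levelDensity K ρ t x ≠ ∞ := by
  have h1 : ENNReal.ofReal t * ∫⁻ x, levelDensity K ρ t x ≤ ∫⁻ x, density K ρ x := by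
    rw [← lintegral_const_mul _ (hT.measurable_levelDensity t)]
    refine lintegral_mono fun x => ?_
    by_cases hx : x ∈ levelSet K ρ t
    · simp only [levelDensity, density, indicator_of_mem hx, indicator_of_mem hx.1, Pi.one_apply,
        mul_one]
      exact ENNReal.ofReal_le_ofReal hx.2.le
    · simp [levelDensity, hx]
  intro h
  rw [h, ENNReal.mul_top (by simpa using ht)] at h1
  exact hT.lintegral_density_ne_top (top_le_iff.1 h1)

/-- The density is finite everywhere, so `F` need not be measurable; `F` is often itself an integral
against a kernel. -/
lemma lintegral_mass (F : Space d → ℝ≥0∞) :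
    ∫⁻ x, F x ∂mass K ρ = ∫⁻ x, density K ρ x * F x := by
  rw [mass, lintegral_withDensity_eq_lintegral_mul_non_measurable _ hT.measurable_density]
  · rfl
  · refine ae_of_all _ fun x => ?_
    by_cases hx : x ∈ K <;> simp [density, hx]

lemma lintegral_levelMass (t : ℝ) (F : Space d → ℝ≥0∞) :
    ∫⁻ x, F x ∂levelMass K ρ t = ∫⁻ x, levelDensity K ρ t x * F x := by
  rw [levelMass, lintegral_withDensity_eq_lintegral_mul_non_measurable _
    (hT.measurable_levelDensity t)]
  · rfl
  · refine ae_of_all _ fun x => ?_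
    by_cases hx : x ∈ levelSet K ρ t <;> simp [levelDensity, hx]

lemma measurable_heightDist : Measurable (heightDist ρ) := by
  refine measurable_normalized (Measure.measurable_of_measurable_coe _ fun A hA => ?_)
  simp_rw [Measure.restrict_apply hA]
  have h : MeasurableSet {p : Space d × ℝ | p.2 ∈ A ∧ 0 < p.2 ∧ p.2 < ρ p.1} :=
    (measurable_snd hA).inter ((measurableSet_lt measurable_const measurable_snd).inter
      (measurableSet_lt measurable_snd (hT.measurable.comp measurable_fst)))
  exact measurable_measure_prodMk_left h

omit hT in
lemma setLIntegral_Ioo_height (x : Space d) (hx : x ∈ K) (F : ℝ → ℝ≥0∞) :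
    ∫⁻ t in Ioo 0 (ρ x), F t = ∫⁻ t in Ioi (0 : ℝ), levelDensity K ρ t x * F t := by
  rw [← lintegral_indicator measurableSet_Ioo, ← lintegral_indicator measurableSet_Ioi]
  refine lintegral_congr fun t => ?_
  simp only [indicator, mem_Ioo, mem_Ioi, levelDensity, levelSet, mem_ofPred_eq, hx, true_and,
    Pi.one_apply]
  split_ifs <;> simp_all

/-- Drawing `x` from `ρ` and then a height uniformly on `(0, ρ(x))` is the same as drawing
uniformly below the graph of `ρ`. -/
lemma lintegral_mass_heightDist {F : Space d → ℝ → ℝ≥0∞} (hF : Measurable (Function.uncurry F)) :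
    ∫⁻ x, ∫⁻ t, F x t ∂heightDist ρ x ∂mass K ρ =
      ∫⁻ t in Ioi 0, ∫⁻ x, F x t ∂levelMass K ρ t := by
  have h1 : ∀ x, density K ρ x * ∫⁻ t, F x t ∂heightDist ρ x =
      ∫⁻ t in Ioi (0 : ℝ), levelDensity K ρ t x * F x t := fun x => by
    by_cases hx : x ∈ K
    -- The weight `ρ x` cancels the normalization `1 / ρ x` of the height.
    · have h0 := hT.pos x hx
      rw [heightDist, lintegral_normalized, Measure.restrict_apply_univ, Real.volume_Ioo, sub_zero,
        density, indicator_of_mem hx, ← mul_assoc, ENNReal.mul_inv_cancel (by simpa using h0)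
        ENNReal.ofReal_ne_top, one_mul, setLIntegral_Ioo_height x hx]
    · have : ∀ t, x ∉ levelSet K ρ t := fun t h => hx h.1
      simp [density, levelDensity, hx, this]
  rw [hT.lintegral_mass, lintegral_congr h1, lintegral_lintegral_swap]
  · simp_rw [hT.lintegral_levelMass]
  · exact ((hT.measurable_uncurry_levelDensity.comp measurable_swap).mul hF).aemeasurable

lemma heightDist_isProb {x : Space d} (hx : x ∈ K) : IsProbabilityMeasure (heightDist ρ x) := by
  have := hT.pos x hx
  refine isProbabilityMeasure_normalized ?_ ?_ <;> simp [this]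

lemma lintegral_mass_eq_levels {F : Space d → ℝ≥0∞} (hF : Measurable F) :
    ∫⁻ x, F x ∂mass K ρ = ∫⁻ t in Ioi 0, ∫⁻ x, F x ∂levelMass K ρ t := by
  rw [← hT.lintegral_mass_heightDist (F := fun x _ => F x) (hF.comp measurable_fst),
    hT.lintegral_mass, hT.lintegral_mass]
  refine lintegral_congr fun x => ?_
  by_cases hx : x ∈ K
  · have := hT.heightDist_isProb hx
    simp
  · simp [density, hx]

/-! ### The transition kernels -/

lemma hitAndRun_eq (x : Space d) :
    hitAndRun K ρ x = (sphereUniform d).bind fun θ => chordDist (density K ρ) x θ := by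
  unfold hitAndRun chordDist density
  simp_rw [restrict_chord_lineMeasure, withDensity_indicator hT.measurableSet]

lemma hybridSlice_eq (x : Space d) :
    hybridSlice K ρ x = ((heightDist ρ x).prod (sphereUniform d)).bind fun p =>
      chordDist (levelDensity K ρ p.1) x p.2 := by
  unfold hybridSlice chordDist levelDensity heightDist
  congr 1
  funext p
  rw [restrict_chord_lineMeasure, withDensity_indicator_one (hT.measurableSet_levelSet p.1)]

lemma simpleSlice_eq (x : Space d) :
    simpleSlice K ρ x = (heightDist ρ x).bind fun t => normalized (levelMass K ρ t) := by
  unfold simpleSlice heightDist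
  simp_rw [hT.levelMass_eq]

lemma measurable_chordDist_density :
    Measurable fun p : Space d × Direction d => chordDist (density K ρ) p.1 p.2 :=
  measurable_chordDist (h := fun _ => density K ρ) (hT.measurable_density.comp measurable_snd)
    measurable_fst measurable_snd

lemma measurable_chordDist_levelDensity :
    Measurable fun p : Space d × ℝ × Direction d =>
      chordDist (levelDensity K ρ p.2.1) p.1 p.2.2 :=
  measurable_chordDist (h := fun p : Space d × ℝ × Direction d => levelDensity K ρ p.2.1)
    (hT.measurable_uncurry_levelDensity.comp (g := Function.uncurry (levelDensity K ρ))
      (f := fun p : (Space d × ℝ × Direction d) × Space d => (p.1.2.1, p.2)) (by fun_prop))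
    measurable_fst (by fun_prop)

lemma measurable_levelMass : Measurable (levelMass K ρ) := by
  refine Measure.measurable_of_measurable_coe _ fun A hA => ?_
  unfold levelMass
  simp_rw [withDensity_apply _ hA]
  exact Measurable.lintegral_prod_right' hT.measurable_uncurry_levelDensity

lemma measurable_hitAndRun : Measurable (hitAndRun K ρ) := by
  rw [funext hT.hitAndRun_eq]
  exact measurable_bind_kernel (Kernel.const (Space d) (sphereUniform d))
    hT.measurable_chordDist_density

lemma measurable_hybridSlice : Measurable (hybridSlice K ρ) := by
  rw [funext hT.hybridSlice_eq]
  let κ : Kernel (Space d) ℝ := ⟨heightDist ρ, hT.measurable_heightDist⟩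
  have : IsFiniteKernel κ := ⟨1, ENNReal.one_lt_top, fun _ => normalized_univ_le_one _⟩
  have h := measurable_bind_kernel (κ ×ₖ Kernel.const (Space d) (sphereUniform d))
    (g := fun x p => chordDist (levelDensity K ρ p.1) x p.2) hT.measurable_chordDist_levelDensity
  simp only [Kernel.prod_apply, Kernel.const_apply] at h
  exact h

lemma measurable_simpleSlice : Measurable (simpleSlice K ρ) := by
  rw [funext hT.simpleSlice_eq]
  exact (Measure.measurable_bind' (measurable_normalized hT.measurable_levelMass)).comp
    hT.measurable_heightDist

omit hT in
lemma sphereUniform_univ_le_one : sphereUniform d univ ≤ 1 := normalized_univ_le_one _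

lemma hitAndRun_univ_le_one (x : Space d) : hitAndRun K ρ x univ ≤ 1 := by
  rw [hT.hitAndRun_eq]
  exact bind_univ_le_one sphereUniform_univ_le_one fun _ => normalized_univ_le_one _

lemma hybridSlice_univ_le_one (x : Space d) : hybridSlice K ρ x univ ≤ 1 := by
  rw [hT.hybridSlice_eq]
  refine bind_univ_le_one ?_ fun _ => normalized_univ_le_one _
  rw [← univ_prod_univ, Measure.prod_prod]
  exact mul_le_one' (normalized_univ_le_one _) sphereUniform_univ_le_one

lemma simpleSlice_univ_le_one (x : Space d) : simpleSlice K ρ x univ ≤ 1 := by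
  rw [hT.simpleSlice_eq]
  exact bind_univ_le_one (normalized_univ_le_one _) fun _ => normalized_univ_le_one _

lemma lintegral_mass_hitAndRun {F : Space d → Space d → ℝ≥0∞}
    (hF : Measurable (Function.uncurry F)) :
    ∫⁻ x, ∫⁻ y, F x y ∂hitAndRun K ρ x ∂mass K ρ =
      ∫⁻ θ, ∫⁻ x, ∫⁻ y, F x y ∂chordDist (density K ρ) x θ ∂mass K ρ ∂sphereUniform d := by
  have hm : Measurable fun p : Space d × Direction d =>
      ∫⁻ y, F p.1 y ∂chordDist (density K ρ) p.1 p.2 :=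
    measurable_lintegral_of_isFinite hT.measurable_chordDist_density
      (fun _ => normalized_univ_le_one _)
      (hF.comp (f := fun p : (Space d × Direction d) × Space d => (p.1.1, p.2)) (by fun_prop))
  refine Eq.trans (lintegral_congr fun x => ?_) (lintegral_lintegral_swap
    (f := fun x θ => ∫⁻ y, F x y ∂chordDist (density K ρ) x θ) hm.aemeasurable)
  have h1 : Measurable fun θ => chordDist (density K ρ) x θ :=
    measurable_chordDist (h := fun _ => density K ρ) (hT.measurable_density.comp measurable_snd)
      measurable_const measurable_id
  have h2 : Measurable (F x) := hF.comp measurable_prodMk_left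
  rw [hT.hitAndRun_eq, Measure.lintegral_bind h1.aemeasurable h2.aemeasurable]

lemma lintegral_mass_hybridSlice {F : Space d → Space d → ℝ≥0∞}
    (hF : Measurable (Function.uncurry F)) :
    ∫⁻ x, ∫⁻ y, F x y ∂hybridSlice K ρ x ∂mass K ρ =
      ∫⁻ t in Ioi 0, ∫⁻ θ, ∫⁻ x, ∫⁻ y, F x y ∂chordDist (levelDensity K ρ t) x θ
        ∂levelMass K ρ t ∂sphereUniform d := by
  have hm : Measurable fun p : Space d × ℝ × Direction d =>
      ∫⁻ y, F p.1 y ∂chordDist (levelDensity K ρ p.2.1) p.1 p.2.2 :=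
    measurable_lintegral_of_isFinite hT.measurable_chordDist_levelDensity
      (fun _ => normalized_univ_le_one _)
      (hF.comp (f := fun p : (Space d × ℝ × Direction d) × Space d => (p.1.1, p.2)) (by fun_prop))
  have h1 : ∀ x, ∫⁻ y, F x y ∂hybridSlice K ρ x = ∫⁻ t, ∫⁻ θ, ∫⁻ y, F x y
      ∂chordDist (levelDensity K ρ t) x θ ∂sphereUniform d ∂heightDist ρ x := fun x => by
    have h1 : Measurable fun p : ℝ × Direction d => chordDist (levelDensity K ρ p.1) x p.2 :=
      measurable_chordDist (h := fun p : ℝ × Direction d => levelDensity K ρ p.1)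
        (hT.measurable_uncurry_levelDensity.comp
          (measurable_fst.fst.prodMk measurable_snd))
        measurable_const measurable_snd
    have h2 : Measurable (F x) := hF.comp measurable_prodMk_left
    have h3 : Measurable fun p : ℝ × Direction d =>
      ∫⁻ y, F x y ∂chordDist (levelDensity K ρ p.1) x p.2 :=
      hm.comp (f := fun p => (x, p)) measurable_prodMk_left
    rw [hT.hybridSlice_eq, Measure.lintegral_bind h1.aemeasurable h2.aemeasurable,
      lintegral_prod _ h3.aemeasurable]
  simp_rw [h1]
  rw [hT.lintegral_mass_heightDist]
  · refine lintegral_congr fun t => ?_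
    have h4 : Measurable fun p : Space d × Direction d => (p.1, t, p.2) := by fun_prop
    exact lintegral_lintegral_swap
      (f := fun x θ => ∫⁻ y, F x y ∂chordDist (levelDensity K ρ t) x θ) (hm.comp h4).aemeasurable
  · exact Measurable.lintegral_prod_right' (f := fun p : (Space d × ℝ) × Direction d =>
      ∫⁻ y, F p.1.1 y ∂chordDist (levelDensity K ρ p.1.2) p.1.1 p.2)
      (hm.comp (f := fun p : (Space d × ℝ) × Direction d => (p.1.1, p.1.2, p.2)) (by fun_prop))

lemma lintegral_mass_simpleSlice {F : Space d → Space d → ℝ≥0∞}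
    (hF : Measurable (Function.uncurry F)) :
    ∫⁻ x, ∫⁻ y, F x y ∂simpleSlice K ρ x ∂mass K ρ =
      ∫⁻ t in Ioi 0, ∫⁻ x, ∫⁻ y, F x y ∂normalized (levelMass K ρ t) ∂levelMass K ρ t := by
  have hn := measurable_normalized hT.measurable_levelMass
  have hm : Measurable fun p : Space d × ℝ => ∫⁻ y, F p.1 y ∂normalized (levelMass K ρ p.2) :=
    measurable_lintegral_of_isFinite (hn.comp measurable_snd) (fun _ => normalized_univ_le_one _)
      (hF.comp (f := fun p : (Space d × ℝ) × Space d => (p.1.1, p.2)) (by fun_prop))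
  rw [← hT.lintegral_mass_heightDist
    (F := fun x t => ∫⁻ y, F x y ∂normalized (levelMass K ρ t)) hm]
  refine lintegral_congr fun x => ?_
  have h2 : Measurable (F x) := hF.comp measurable_prodMk_left
  rw [hT.simpleSlice_eq, Measure.lintegral_bind hn.aemeasurable h2.aemeasurable]

end IsTargetDensity

lemma isAveraging_const {α : Type*} [MeasurableSpace α] {μ : Measure α} (h : μ univ ≠ ∞) :
    IsAveraging μ (Kernel.const α (normalized μ)) := by
  -- The zero measure has to be covered: high level sets may be null.
  by_cases h0 : μ = 0
  · subst h0
    exact ⟨by simp, by simp, fun x => by simp⟩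
  have h0' : μ univ ≠ 0 := by simpa using h0
  refine ⟨ae_of_all _ fun x => ?_, ?_, fun x => by simp⟩
  · rw [Kernel.const_apply]
    exact isProbabilityMeasure_normalized h0' h
  · show μ.bind (fun _ => normalized μ) = μ
    rw [Measure.bind_const, normalized, smul_smul, ENNReal.mul_inv_cancel h0' h, one_smul]

/-! ### Invariance of the slice and hit-and-run samplers; comparison of U with H and S. -/

namespace IsTargetDensity

variable {K : Set (Space d)} {ρ : Space d → ℝ} (hT : IsTargetDensity K ρ)

include hT

lemma isAveraging_density (θ : Direction d) :
    IsAveraging (mass K ρ) (chordKernel (density K ρ) hT.measurable_density θ) :=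
  isAveraging_chordKernel _ θ hT.lintegral_density_ne_top

lemma isAveraging_levelDensity {t : ℝ} (ht : 0 < t) (θ : Direction d) :
    IsAveraging (levelMass K ρ t)
      (chordKernel (levelDensity K ρ t) (hT.measurable_levelDensity t) θ) :=
  isAveraging_chordKernel _ θ (hT.lintegral_levelDensity_ne_top ht)

lemma isAveraging_levelSet {t : ℝ} (ht : 0 < t) :
    IsAveraging (levelMass K ρ t) (Kernel.const (Space d) (normalized (levelMass K ρ t))) := by
  refine isAveraging_const ?_
  rw [levelMass, withDensity_apply _ MeasurableSet.univ, Measure.restrict_univ]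
  exact hT.lintegral_levelDensity_ne_top ht

lemma bind_hitAndRun (hd : 0 < d) : (mass K ρ).bind (hitAndRun K ρ) = mass K ρ := by
  have := isProbabilityMeasure_sphereUniform hd
  refine Measure.ext_of_lintegral _ fun F hF => ?_
  rw [Measure.lintegral_bind hT.measurable_hitAndRun.aemeasurable hF.aemeasurable,
    hT.lintegral_mass_hitAndRun (F := fun _ => F) (hF.comp measurable_snd)]
  have h1 : ∀ θ : Direction d, ∫⁻ x, ∫⁻ y, F y ∂chordDist (density K ρ) x θ ∂mass K ρ =
      ∫⁻ x, F x ∂mass K ρ := fun θ => (hT.isAveraging_density θ).lintegral_lintegral hF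
  simp_rw [h1]
  simp

lemma bind_hybridSlice (hd : 0 < d) : (mass K ρ).bind (hybridSlice K ρ) = mass K ρ := by
  have := isProbabilityMeasure_sphereUniform hd
  refine Measure.ext_of_lintegral _ fun F hF => ?_
  rw [Measure.lintegral_bind hT.measurable_hybridSlice.aemeasurable hF.aemeasurable,
    hT.lintegral_mass_hybridSlice (F := fun _ => F) (hF.comp measurable_snd),
    hT.lintegral_mass_eq_levels hF]
  refine setLIntegral_congr_fun measurableSet_Ioi fun t ht => ?_
  have h1 : ∀ θ : Direction d, ∫⁻ x, ∫⁻ y, F y ∂chordDist (levelDensity K ρ t) x θ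
      ∂levelMass K ρ t = ∫⁻ x, F x ∂levelMass K ρ t :=
    fun θ => (hT.isAveraging_levelDensity ht θ).lintegral_lintegral hF
  simp_rw [h1]
  simp

lemma bind_simpleSlice : (mass K ρ).bind (simpleSlice K ρ) = mass K ρ := by
  refine Measure.ext_of_lintegral _ fun F hF => ?_
  rw [Measure.lintegral_bind hT.measurable_simpleSlice.aemeasurable hF.aemeasurable,
    hT.lintegral_mass_simpleSlice (F := fun _ => F) (hF.comp measurable_snd),
    hT.lintegral_mass_eq_levels hF]
  refine setLIntegral_congr_fun measurableSet_Ioi fun t ht => ?_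
  exact (hT.isAveraging_levelSet ht).lintegral_lintegral hF

omit hT in
lemma measurable_uncurry_sq_sub {f : Space d → ℝ} (hf : Measurable f) :
    Measurable (Function.uncurry fun x y => ENNReal.ofReal ((f x - f y) ^ 2)) := by
  unfold Function.uncurry
  fun_prop

lemma dirichlet_hybridSlice {f : Space d → ℝ} (hf : Measurable f) :
    dirichlet (mass K ρ) (hybridSlice K ρ) f =
      ∫⁻ t in Ioi 0, ∫⁻ θ, dirichlet (levelMass K ρ t)
        (chordKernel (levelDensity K ρ t) (hT.measurable_levelDensity t) θ) f ∂sphereUniform d :=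
  hT.lintegral_mass_hybridSlice (measurable_uncurry_sq_sub hf)

lemma dirichlet_simpleSlice {f : Space d → ℝ} (hf : Measurable f) :
    dirichlet (mass K ρ) (simpleSlice K ρ) f =
      ∫⁻ t in Ioi 0, dirichlet (levelMass K ρ t)
        (Kernel.const (Space d) (normalized (levelMass K ρ t))) f :=
  hT.lintegral_mass_simpleSlice (measurable_uncurry_sq_sub hf)

lemma dirichlet_hitAndRun {f : Space d → ℝ} (hf : Measurable f) :
    dirichlet (mass K ρ) (hitAndRun K ρ) f =
      ∫⁻ θ, dirichlet (mass K ρ)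
        (chordKernel (density K ρ) hT.measurable_density θ) f ∂sphereUniform d :=
  hT.lintegral_mass_hitAndRun (measurable_uncurry_sq_sub hf)

/-- The uniform distribution on a level set averages more than the one on its chords. -/
theorem dirichlet_hybridSlice_le_simpleSlice (hd : 0 < d) {f : Space d → ℝ} (hf : Measurable f) :
    dirichlet (mass K ρ) (hybridSlice K ρ) f ≤ dirichlet (mass K ρ) (simpleSlice K ρ) f := by
  have := isProbabilityMeasure_sphereUniform hd
  rw [hT.dirichlet_hybridSlice hf, hT.dirichlet_simpleSlice hf]
  refine setLIntegral_mono' measurableSet_Ioi fun t ht => ?_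
  rw [(hT.isAveraging_levelSet ht).dirichlet_eq hf]
  -- The mean over the whole level set is a constant, hence an admissible `g` for every direction;
  -- averaging over `θ` changes nothing.
  refine (lintegral_mono fun θ => (hT.isAveraging_levelDensity ht θ).dirichlet_le hf
    (g := fun _ => ∫ y, f y ∂normalized (levelMass K ρ t)) measurable_const
    fun x => ae_of_all _ fun _ => rfl).trans_eq ?_
  simp

lemma measurable_integral_chordDist {f : Space d → ℝ} (hf : Measurable f) :
    Measurable fun p : Space d × Direction d =>
      ∫ y, f y ∂chordDist (density K ρ) p.1 p.2 := by
  let κ : Kernel (Space d × Direction d) (Space d) := ⟨_, hT.measurable_chordDist_density⟩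
  exact (hf.stronglyMeasurable.integral_kernel (κ := κ)).measurable

/-- The distribution proportional to `ρ` on a chord averages more than the uniform distribution on
the part of that chord inside a level set. -/
theorem dirichlet_hybridSlice_le_hitAndRun {f : Space d → ℝ} (hf : Measurable f) :
    dirichlet (mass K ρ) (hybridSlice K ρ) f ≤ dirichlet (mass K ρ) (hitAndRun K ρ) f := by
  have hm := hT.measurable_integral_chordDist hf
  set m : Space d → Direction d → ℝ := fun x θ => ∫ y, f y ∂chordDist (density K ρ) x θ
  have hm1 : ∀ θ, Measurable fun x => m x θ := fun θ =>
    hm.comp (f := fun x => (x, θ)) measurable_prodMk_right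
  have h1 : ∀ t ∈ Ioi (0 : ℝ), ∀ θ : Direction d, dirichlet (levelMass K ρ t)
      (chordKernel (levelDensity K ρ t) (hT.measurable_levelDensity t) θ) f ≤
      2 * ∫⁻ x, ENNReal.ofReal ((f x - m x θ) ^ 2) ∂levelMass K ρ t := fun t ht θ => by
    -- `m x θ` depends only on the line through `x`, so it is constant along every chord of `K(t)`
    -- in direction `θ`.
    refine (hT.isAveraging_levelDensity ht θ).dirichlet_le hf (hm1 θ) fun x => ?_
    rw [chordKernel_apply]
    filter_upwards [ae_chordDist (h := levelDensity K ρ t) θ x] with z hz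
    obtain ⟨s, rfl⟩ := hz
    simp only [m, chordDist_add_smul]
  have h2 : ∀ θ : Direction d, dirichlet (mass K ρ)
      (chordKernel (density K ρ) hT.measurable_density θ) f =
      ∫⁻ t in Ioi 0, 2 * ∫⁻ x, ENNReal.ofReal ((f x - m x θ) ^ 2) ∂levelMass K ρ t := fun θ => by
    have h3 : Measurable fun x => ENNReal.ofReal ((f x - m x θ) ^ 2) :=
      ((hf.sub (hm1 θ)).pow_const 2).ennreal_ofReal
    -- For hit-and-run `m` is the exact conditional mean, giving equality; the layer-cake formula
    -- then slices the deviation by level.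
    rw [(hT.isAveraging_density θ).dirichlet_eq hf, lintegral_const_mul' _ _ (by simp),
      ← hT.lintegral_mass_eq_levels h3]
    rfl
  rw [hT.dirichlet_hybridSlice hf, hT.dirichlet_hitAndRun hf, lintegral_congr h2]
  refine (setLIntegral_mono' measurableSet_Ioi fun t ht => lintegral_mono (h1 t ht)).trans_eq
    (lintegral_lintegral_swap
      (f := fun t θ => 2 * ∫⁻ x, ENNReal.ofReal ((f x - m x θ) ^ 2) ∂levelMass K ρ t) ?_)
  simp_rw [hT.lintegral_levelMass]
  refine (Measurable.const_mul ?_ _).aemeasurable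
  refine Measurable.lintegral_prod_right' (f := fun p : (ℝ × Direction d) × Space d =>
    levelDensity K ρ p.1.1 p.2 * ENNReal.ofReal ((f p.2 - m p.2 p.1.2) ^ 2)) ?_
  refine (hT.measurable_uncurry_levelDensity.comp
    (measurable_fst.fst.prodMk measurable_snd)).mul ?_
  have h4 : Measurable fun p : (ℝ × Direction d) × Space d => m p.2 p.1.2 :=
    hm.comp (f := fun p : (ℝ × Direction d) × Space d => (p.2, p.1.2)) (by fun_prop)
  fun_prop

end IsTargetDensity

/-! ### Polar coordinates and rotationally invariant densities. -/

/-- The total mass of the surface measure of the unit sphere. -/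
noncomputable def sphereArea (d : ℕ) : ℝ≥0∞ := (volume : Measure (Space d)).toSphere univ

lemma sphereArea_ne_top : sphereArea d ≠ ∞ := measure_ne_top _ _

/-- Integration in polar coordinates. -/
lemma lintegral_polar (hd : 0 < d) {Φ : Space d → ℝ≥0∞} (hΦ : Measurable Φ) :
    ∫⁻ z, Φ z = ∫⁻ θ, sphereArea d * ∫⁻ r, Φ ((r : ℝ) • (θ : Space d))
      ∂Measure.volumeIoiPow (d - 1) ∂sphereUniform d := by
  have : NeZero d := ⟨hd.ne'⟩
  have hC : sphereArea d ≠ 0 := by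
    rw [sphereArea, Ne, Measure.measure_univ_eq_zero]
    exact Measure.toSphere_ne_zero _
  have hg : Measurable fun p : Direction d × Ioi (0 : ℝ) => Φ ((p.2 : ℝ) • (p.1 : Space d)) := by
    fun_prop
  have h1 := (volume : Measure (Space d)).measurePreserving_homeomorphUnitSphereProd.lintegral_comp
    hg
  have h2 : ∀ z : ({0}ᶜ : Set (Space d)),
      Φ (((homeomorphUnitSphereProd (Space d) z).2 : ℝ) •
        ((homeomorphUnitSphereProd (Space d) z).1 : Space d)) = Φ z := fun z => by
    have : ‖(z : Space d)‖ ≠ 0 := norm_ne_zero_iff.2 z.2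
    simp [smul_smul, this]
  simp_rw [h2] at h1
  rw [lintegral_subtype_comap (measurableSet_singleton (0 : Space d)).compl,
    restrict_compl_singleton, lintegral_prod _ hg.aemeasurable,
    finrank_euclideanSpace_fin] at h1
  rw [h1, lintegral_const_mul' _ _ sphereArea_ne_top, sphereUniform, lintegral_normalized,
    ← mul_assoc, ← sphereArea, ENNReal.mul_inv_cancel hC sphereArea_ne_top, one_mul]

namespace IsRotInvDensity

variable {q : Space d → ℝ} (hq : IsRotInvDensity q)

include hq

lemma lintegral_eq_one : ∫⁻ z, ENNReal.ofReal (q z) = 1 := by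
  have hi : Integrable q := by
    by_contra h
    simpa [integral_undef h] using hq.integral_eq_one
  rw [← ofReal_integral_eq_lintegral_ofReal hi (ae_of_all _ hq.nonneg), hq.integral_eq_one,
    ENNReal.ofReal_one]

/-- Opposite directions are related by rotational invariance. This symmetry of the proposal gives
Metropolis its detailed balance. -/
lemma apply_neg (hd : 0 < d) (z : Space d) : q (-z) = q z := by
  have : NeZero d := ⟨hd.ne'⟩
  obtain ⟨θ, hθ⟩ : ∃ θ : Direction d, z = ‖z‖ • (θ : Space d) := by
    by_cases hz : z = 0
    · obtain ⟨v, hv⟩ := (NormedSpace.sphere_nonempty (E := Space d) (x := 0) (r := 1)).2 zero_le_one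
      exact ⟨⟨v, hv⟩, by simp [hz]⟩
    · refine ⟨⟨‖z‖⁻¹ • z, ?_⟩, ?_⟩
      · simp [norm_smul, hz]
      · simp [smul_smul, hz]
  have := hq.rotInv ‖z‖ (-θ) θ
  rw [coe_neg_sphere, smul_neg, ← hθ] at this
  exact this

/-- The radial part of a rotationally invariant probability density has total mass one. -/
lemma lintegral_radial (hd : 0 < d) (θ : Direction d) :
    sphereArea d * ∫⁻ r, ENNReal.ofReal (q ((r : ℝ) • (θ : Space d)))
      ∂Measure.volumeIoiPow (d - 1) = 1 := by
  have := isProbabilityMeasure_sphereUniform hd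
  have h := lintegral_polar hd hq.measurable.ennreal_ofReal
  rw [hq.lintegral_eq_one] at h
  -- The radial integral is now the same in all directions, so its spherical average is its value at
  -- `θ`.
  simp_rw [fun (r : Ioi (0 : ℝ)) (θ' : Direction d) => hq.rotInv r θ' θ] at h
  simpa using h.symm

end IsRotInvDensity

/-! ### The Metropolis kernel and its invariant measure. -/

/-- `J(x, y) = min(ρ(x), ρ(y))` on `K × K`, zero otherwise. -/
noncomputable def jointDensity (K : Set (Space d)) (ρ : Space d → ℝ) (x y : Space d) : ℝ≥0∞ :=
  ∫⁻ t in Ioi 0, levelDensity K ρ t x * levelDensity K ρ t y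

lemma jointDensity_comm (K : Set (Space d)) (ρ : Space d → ℝ) (x y : Space d) :
    jointDensity K ρ x y = jointDensity K ρ y x := by
  simp_rw [jointDensity, mul_comm]

lemma jointDensity_of_mem {K : Set (Space d)} (ρ : Space d → ℝ) {x y : Space d} (hx : x ∈ K)
    (hy : y ∈ K) : jointDensity K ρ x y = ENNReal.ofReal (min (ρ x) (ρ y)) := by
  rw [jointDensity, ← lintegral_indicator measurableSet_Ioi]
  have : (Ioi (0 : ℝ)).indicator (fun t => levelDensity K ρ t x * levelDensity K ρ t y) =
      (Ioo 0 (min (ρ x) (ρ y))).indicator 1 := by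
    ext t
    simp only [indicator, mem_Ioi, levelDensity, levelSet, mem_ofPred_eq, hx, hy, true_and,
      Pi.one_apply, mem_Ioo, lt_min_iff]
    split_ifs <;> simp_all
  rw [this, lintegral_indicator_one measurableSet_Ioo, Real.volume_Ioo, sub_zero]

lemma jointDensity_of_notMem {K : Set (Space d)} (ρ : Space d → ℝ) {x y : Space d}
    (h : ¬ (x ∈ K ∧ y ∈ K)) : jointDensity K ρ x y = 0 := by
  have : ∀ t, levelDensity K ρ t x * levelDensity K ρ t y = 0 := fun t => by
    by_cases hx : x ∈ levelSet K ρ t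
    · have hy : y ∉ levelSet K ρ t := fun hy => h ⟨hx.1, hy.1⟩
      simp [levelDensity, hy]
    · simp [levelDensity, hx]
  simp [jointDensity, this]

/-- The density of the accepted moves. -/
noncomputable def moveDensity (K : Set (Space d)) (ρ q : Space d → ℝ) (x y : Space d) : ℝ≥0∞ :=
  ENNReal.ofReal (1 / 2 * (acceptance K ρ x y * q (y - x)))

namespace IsTargetDensity

variable {K : Set (Space d)} {ρ q : Space d → ℝ} (hT : IsTargetDensity K ρ)

include hT

lemma measurable_jointDensity : Measurable (Function.uncurry (jointDensity K ρ)) := by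
  refine Measurable.lintegral_prod_right' (f := fun p : (Space d × Space d) × ℝ =>
    levelDensity K ρ p.2 p.1.1 * levelDensity K ρ p.2 p.1.2) ?_
  exact (hT.measurable_uncurry_levelDensity.comp (measurable_snd.prodMk measurable_fst.fst)).mul
    (hT.measurable_uncurry_levelDensity.comp (measurable_snd.prodMk measurable_fst.snd))

/-- Detailed balance: `ρ x · min(1, ρ y / ρ x) = min(ρ x, ρ y)` is symmetric, and `jointDensity`
presents it as an integral over levels. -/
lemma density_mul_moveDensity (x y : Space d) :
    density K ρ x * moveDensity K ρ q x y =
      2⁻¹ * (jointDensity K ρ x y * ENNReal.ofReal (q (y - x))) := by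
  by_cases h : x ∈ K ∧ y ∈ K
  · have h0 := hT.pos x h.1
    have h1 := hT.pos y h.2
    have h2 : ρ x * min 1 (ρ y / ρ x) = min (ρ x) (ρ y) := by
      rw [mul_min_of_nonneg _ _ h0.le, mul_one, mul_div_cancel₀ _ h0.ne']
    rw [jointDensity_of_mem ρ h.1 h.2, density, indicator_of_mem h.1, moveDensity, acceptance,
      indicator_of_mem (show (x, y) ∈ K ×ˢ K from h), ← ENNReal.ofReal_mul h0.le, ← h2,
      ← ENNReal.ofReal_mul (by positivity), show (2⁻¹ : ℝ≥0∞) = ENNReal.ofReal (1 / 2) by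
        rw [one_div, ENNReal.ofReal_inv_of_pos (by norm_num)]; simp,
      ← ENNReal.ofReal_mul (by norm_num)]
    congr 1
    ring
  · have : (x, y) ∉ K ×ˢ K := h
    simp [jointDensity_of_notMem ρ h, moveDensity, acceptance, this]

lemma measurable_moveDensity (hq : IsRotInvDensity q) :
    Measurable (Function.uncurry (moveDensity K ρ q)) := by
  have h1 : Measurable fun p : Space d × Space d => acceptance K ρ p.1 p.2 := by
    refine Measurable.indicator ?_ (hT.measurableSet.prod hT.measurableSet)
    exact measurable_const.min
      ((hT.measurable.comp measurable_snd).div (hT.measurable.comp measurable_fst))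
  have h2 : Measurable fun p : Space d × Space d => q (p.2 - p.1) :=
    hq.measurable.comp (by fun_prop)
  exact ((h1.mul h2).const_mul _).ennreal_ofReal

lemma metropolisMove_eq (x : Space d) :
    metropolisMove K ρ q x = volume.withDensity (moveDensity K ρ q x) := by
  have h1 : K.indicator (moveDensity K ρ q x) = moveDensity K ρ q x := by
    ext y
    by_cases hy : y ∈ K
    · rw [indicator_of_mem hy]
    · have : (x, y) ∉ K ×ˢ K := fun h => hy h.2
      simp [hy, moveDensity, acceptance, this]
  rw [← h1, withDensity_indicator hT.measurableSet]
  rfl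

lemma lintegral_metropolisMove (hq : IsRotInvDensity q) (x : Space d) {F : Space d → ℝ≥0∞}
    (hF : Measurable F) :
    ∫⁻ y, F y ∂metropolisMove K ρ q x = ∫⁻ y, moveDensity K ρ q x y * F y := by
  have h1 : Measurable (moveDensity K ρ q x) :=
    (hT.measurable_moveDensity hq).comp measurable_prodMk_left
  rw [hT.metropolisMove_eq, lintegral_withDensity_eq_lintegral_mul _ h1 hF]
  rfl

lemma density_mul_lintegral_metropolisMove (hq : IsRotInvDensity q) (x : Space d)
    {F : Space d → ℝ≥0∞} (hF : Measurable F) :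
    density K ρ x * ∫⁻ y, F y ∂metropolisMove K ρ q x =
      2⁻¹ * ∫⁻ y, jointDensity K ρ x y * ENNReal.ofReal (q (y - x)) * F y := by
  have hd : density K ρ x ≠ ∞ := by
    by_cases hx : x ∈ K <;> simp [density, hx]
  rw [hT.lintegral_metropolisMove hq x hF, ← lintegral_const_mul' _ _ hd,
    ← lintegral_const_mul' _ _ (by simp)]
  refine lintegral_congr fun y => ?_
  rw [← mul_assoc, hT.density_mul_moveDensity, mul_assoc]

lemma metropolisMove_univ_le_one (hq : IsRotInvDensity q) (x : Space d) :
    metropolisMove K ρ q x univ ≤ 1 := by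
  rw [hT.metropolisMove_eq, withDensity_apply _ MeasurableSet.univ, Measure.restrict_univ,
    ← hq.lintegral_eq_one, ← lintegral_sub_right_eq_self (fun z => ENNReal.ofReal (q z)) x]
  refine lintegral_mono fun y => ENNReal.ofReal_le_ofReal ?_
  have h1 : acceptance K ρ x y ≤ 1 := by
    unfold acceptance
    exact indicator_le' (fun _ _ => min_le_left _ _) (fun _ _ => zero_le_one) _
  have := hq.nonneg (y - x)
  nlinarith

/-- Accepted moves land in `K`, and `{x}` is a null set in positive dimension. -/
lemma metropolis_eq (hd : 0 < d) (x : Space d) :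
    metropolis K ρ q x = metropolisMove K ρ q x +
      (1 - metropolisMove K ρ q x univ) • Measure.dirac x := by
  have : NeZero d := ⟨hd.ne'⟩
  have h1 : metropolisMove K ρ q x (K \ {x}) = metropolisMove K ρ q x univ := by
    refine measure_congr (Filter.eventuallyEq_univ.2 ?_)
    refine (withDensity_absolutelyContinuous _ _).ae_le ?_
    filter_upwards [ae_restrict_mem hT.measurableSet, ae_restrict_of_ae (Measure.ae_ne volume x)]
      with y h2 h3
    exact ⟨h2, h3⟩
  rw [metropolis, h1]

lemma measurable_metropolis (hd : 0 < d) (hq : IsRotInvDensity q) :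
    Measurable (metropolis K ρ q) := by
  have h1 : Measurable (metropolisMove K ρ q) := by
    rw [funext hT.metropolisMove_eq]
    refine Measure.measurable_of_measurable_coe _ fun A hA => ?_
    simp_rw [withDensity_apply _ hA]
    exact Measurable.lintegral_prod_right' (hT.measurable_moveDensity hq)
  rw [funext (hT.metropolis_eq hd)]
  refine Measure.measurable_of_measurable_coe _ fun A hA => ?_
  simp only [Measure.add_apply, Measure.smul_apply, smul_eq_mul]
  exact ((Measure.measurable_coe hA).comp h1).add
    ((measurable_const.sub ((Measure.measurable_coe MeasurableSet.univ).comp h1)).mul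
      ((Measure.measurable_coe hA).comp Measure.measurable_dirac))

lemma metropolis_univ (hd : 0 < d) (hq : IsRotInvDensity q) (x : Space d) :
    metropolis K ρ q x univ = 1 := by
  rw [hT.metropolis_eq hd, Measure.add_apply, Measure.smul_apply,
    measure_univ (μ := Measure.dirac x), smul_eq_mul, mul_one, add_tsub_cancel_of_le (hT.metropolisMove_univ_le_one hq x)]

lemma lintegral_metropolis (hd : 0 < d) (x : Space d) {F : Space d → ℝ≥0∞} (hF : Measurable F) :
    ∫⁻ y, F y ∂metropolis K ρ q x =
      ∫⁻ y, F y ∂metropolisMove K ρ q x + (1 - metropolisMove K ρ q x univ) * F x := by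
  rw [hT.metropolis_eq hd, lintegral_add_measure, lintegral_smul_measure, lintegral_dirac' _ hF,
    smul_eq_mul]

lemma bind_metropolis (hd : 0 < d) (hq : IsRotInvDensity q) :
    (mass K ρ).bind (metropolis K ρ q) = mass K ρ := by
  refine Measure.ext_of_lintegral _ fun F hF => ?_
  have hJ := hT.measurable_jointDensity
  have hQ : Measurable fun p : Space d × Space d => ENNReal.ofReal (q (p.2 - p.1)) :=
    (hq.measurable.comp (by fun_prop)).ennreal_ofReal
  have hJQ : Measurable fun p : Space d × Space d =>
      jointDensity K ρ p.1 p.2 * ENNReal.ofReal (q (p.2 - p.1)) * F p.2 :=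
    (hJ.mul hQ).mul (hF.comp measurable_snd)
  -- The flow into each point equals the flow out of it, by symmetry of `jointDensity` and `q`; the
  -- holding part then restores full mass.
  have h1 : ∫⁻ x, density K ρ x * ∫⁻ y, F y ∂metropolisMove K ρ q x =
      ∫⁻ x, density K ρ x * (metropolisMove K ρ q x univ * F x) := by
    simp_rw [fun x => hT.density_mul_lintegral_metropolisMove hq x hF]
    rw [lintegral_const_mul' _ _ (by simp), lintegral_lintegral_swap hJQ.aemeasurable,
      ← lintegral_const_mul' _ _ (by simp)]
    refine lintegral_congr fun x => ?_
    have h2 : Measurable fun y => jointDensity K ρ y x * ENNReal.ofReal (q (x - y)) :=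
      (hJ.mul hQ).comp measurable_prodMk_right
    have h3 := hT.density_mul_lintegral_metropolisMove hq x (F := fun _ => 1) measurable_const
    simp only [lintegral_const, one_mul, mul_one] at h3
    rw [lintegral_mul_const _ h2, ← mul_assoc, ← mul_assoc, h3]
    congr 2
    refine lintegral_congr fun y => ?_
    rw [jointDensity_comm, ← hq.apply_neg hd, neg_sub]
  have hmove : Measurable fun x => ∫⁻ y, F y ∂metropolisMove K ρ q x := by
    simp_rw [fun x => hT.lintegral_metropolisMove hq x hF]
    exact Measurable.lintegral_prod_right' ((hT.measurable_moveDensity hq).mul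
      (hF.comp measurable_snd))
  rw [Measure.lintegral_bind (hT.measurable_metropolis hd hq).aemeasurable hF.aemeasurable,
    hT.lintegral_mass, hT.lintegral_mass]
  simp_rw [fun x => hT.lintegral_metropolis (q := q) hd x hF, mul_add]
  have h5 : Measurable fun x => density K ρ x * ∫⁻ y, F y ∂metropolisMove K ρ q x :=
    hT.measurable_density.mul hmove
  rw [lintegral_add_left h5, h1, ← lintegral_add_left]
  · refine lintegral_congr fun x => ?_
    rw [← mul_add, ← add_mul, add_tsub_cancel_of_le (hT.metropolisMove_univ_le_one hq x), one_mul]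
  · have h4 := fun x => hT.lintegral_metropolisMove hq x (F := fun _ => 1) measurable_const
    simp only [lintegral_const, one_mul, mul_one] at h4
    simp_rw [h4]
    exact hT.measurable_density.mul
      ((Measurable.lintegral_prod_right' (hT.measurable_moveDensity hq)).mul hF)

end IsTargetDensity

lemma ofReal_sq_sub_le (a b m : ℝ) :
    ENNReal.ofReal ((a - b) ^ 2) ≤
      2 * (ENNReal.ofReal ((a - m) ^ 2) + ENNReal.ofReal ((b - m) ^ 2)) := by
  rw [← ENNReal.ofReal_add (sq_nonneg _) (sq_nonneg _), ← ENNReal.ofReal_ofNat 2,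
    ← ENNReal.ofReal_mul (by norm_num)]
  refine ENNReal.ofReal_le_ofReal ?_
  nlinarith [sq_nonneg ((a - m) + (b - m))]

/-! ### Comparison of Metropolis with hybrid slice sampling. -/

namespace IsTargetDensity

variable {K : Set (Space d)} {ρ q : Space d → ℝ} (hT : IsTargetDensity K ρ)

include hT

/-- Holding contributes nothing, since `f x - f x = 0`. The rest comes from detailed balance, the
substitution `y = x + z` and slicing the minimum by levels. -/
lemma dirichlet_metropolis (hd : 0 < d) (hq : IsRotInvDensity q) {f : Space d → ℝ}
    (hf : Measurable f) :
    dirichlet (mass K ρ) (metropolis K ρ q) f =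
      ∫⁻ t in Ioi 0, 2⁻¹ * ∫⁻ z, ENNReal.ofReal (q z) * ∫⁻ x, levelDensity K ρ t x *
        levelDensity K ρ t (x + z) * ENNReal.ofReal ((f x - f (x + z)) ^ 2) := by
  have hlev := hT.measurable_uncurry_levelDensity
  have h1 : ∀ x, density K ρ x * ∫⁻ y, ENNReal.ofReal ((f x - f y) ^ 2) ∂metropolis K ρ q x =
      ∫⁻ z, ∫⁻ t in Ioi (0 : ℝ), 2⁻¹ * (ENNReal.ofReal (q z) * (levelDensity K ρ t x *
        levelDensity K ρ t (x + z) * ENNReal.ofReal ((f x - f (x + z)) ^ 2))) := fun x => by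
    have hF : Measurable fun y => ENNReal.ofReal ((f x - f y) ^ 2) := by fun_prop
    rw [hT.lintegral_metropolis hd x hF, sub_self, zero_pow two_ne_zero, ENNReal.ofReal_zero,
      mul_zero, add_zero, hT.density_mul_lintegral_metropolisMove hq x hF,
      ← lintegral_add_left_eq_self _ x, ← lintegral_const_mul' _ _ (by simp)]
    refine lintegral_congr fun z => ?_
    have h2 : Measurable fun t => levelDensity K ρ t x * levelDensity K ρ t (x + z) :=
      (hlev.comp (measurable_id.prodMk measurable_const)).mul
        (hlev.comp (measurable_id.prodMk measurable_const))
    rw [add_sub_cancel_left, jointDensity, lintegral_const_mul' _ _ (by simp),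
      lintegral_const_mul' _ _ ENNReal.ofReal_ne_top, lintegral_mul_const _ h2]
    ring
  have hm : Measurable fun p : (Space d × Space d) × ℝ =>
      2⁻¹ * (ENNReal.ofReal (q p.1.2) * (levelDensity K ρ p.2 p.1.1 *
        levelDensity K ρ p.2 (p.1.1 + p.1.2) *
          ENNReal.ofReal ((f p.1.1 - f (p.1.1 + p.1.2)) ^ 2))) := by
    have h3 : Measurable fun p : (Space d × Space d) × ℝ => levelDensity K ρ p.2 p.1.1 :=
      hlev.comp (measurable_snd.prodMk measurable_fst.fst)
    have h4 : Measurable fun p : (Space d × Space d) × ℝ =>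
        levelDensity K ρ p.2 (p.1.1 + p.1.2) :=
      hlev.comp (measurable_snd.prodMk (measurable_fst.fst.add measurable_fst.snd))
    have h5 := hq.measurable
    fun_prop
  rw [dirichlet, hT.lintegral_mass, lintegral_congr h1,
    ← lintegral_prod _ (Measurable.lintegral_prod_right' hm).aemeasurable,
    lintegral_lintegral_swap hm.aemeasurable]
  refine lintegral_congr fun t => ?_
  have hmt : Measurable fun p : Space d × Space d =>
      2⁻¹ * (ENNReal.ofReal (q p.2) * (levelDensity K ρ t p.1 *
        levelDensity K ρ t (p.1 + p.2) *
          ENNReal.ofReal ((f p.1 - f (p.1 + p.2)) ^ 2))) :=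
    hm.comp (f := fun p : Space d × Space d => (p, t)) measurable_prodMk_right
  rw [lintegral_prod_symm _ hmt.aemeasurable, ← lintegral_const_mul' _ _ (by simp)]
  refine lintegral_congr fun z => ?_
  dsimp only
  rw [lintegral_const_mul' _ _ (by simp), lintegral_const_mul' _ _ ENNReal.ofReal_ne_top]

/-- A step of fixed length along direction `θ` inside a level set changes `f` by at most twice the
deviation of `f` from its means along the chords. -/
lemma lintegral_shift_le {t : ℝ} (ht : 0 < t) (θ : Direction d) (r : ℝ) {f : Space d → ℝ}
    (hf : Measurable f) :
    ∫⁻ x, levelDensity K ρ t x * levelDensity K ρ t (x + r • (θ : Space d)) *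
        ENNReal.ofReal ((f x - f (x + r • (θ : Space d))) ^ 2) ≤
      2 * dirichlet (levelMass K ρ t)
        (chordKernel (levelDensity K ρ t) (hT.measurable_levelDensity t) θ) f := by
  set κ := chordKernel (levelDensity K ρ t) (hT.measurable_levelDensity t) θ with hκ
  set h := levelDensity K ρ t
  have hh : Measurable h := hT.measurable_levelDensity t
  have h1 : ∀ x, h x ≤ 1 := indicator_le_self' (fun _ _ => zero_le_one)
  have hm : Measurable fun x => ∫ y, f y ∂κ x :=
    (hf.stronglyMeasurable.integral_kernel (κ := κ)).measurable
  set a : Space d → ℝ≥0∞ := fun x => ENNReal.ofReal ((f x - ∫ y, f y ∂κ x) ^ 2) with ha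
  have ham : Measurable a := by fun_prop
  have hd2 : dirichlet (levelMass K ρ t) κ f = 2 * ∫⁻ x, h x * a x := by
    rw [(hT.isAveraging_levelDensity ht θ).dirichlet_eq hf, hT.lintegral_levelMass]
  have h2 : ∀ x, ENNReal.ofReal ((f x - f (x + r • (θ : Space d))) ^ 2) ≤
      2 * (a x + a (x + r • (θ : Space d))) := fun x => by
    -- Both endpoints lie on one line and share its chord mean, which serves as the midpoint `m` in
    -- `ofReal_sq_sub_le`.
    have h3 : ∫ y, f y ∂κ (x + r • (θ : Space d)) = ∫ y, f y ∂κ x := by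
      rw [hκ, chordKernel_apply, chordDist_add_smul, chordKernel_apply]
    simp only [ha, h3]
    exact ofReal_sq_sub_le _ _ _
  calc _ ≤ ∫⁻ x, 2 * (h x * a x + h (x + r • (θ : Space d)) * a (x + r • (θ : Space d))) := by
        refine lintegral_mono fun x => ?_
        calc _ ≤ h x * h (x + r • (θ : Space d)) * (2 * (a x + a (x + r • (θ : Space d)))) := by
              gcongr; exact h2 x
          _ = 2 * (h x * h (x + r • (θ : Space d)) * a x +
              h x * h (x + r • (θ : Space d)) * a (x + r • (θ : Space d))) := by ring
          _ ≤ _ := by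
              -- In each summand, the indicator at the other endpoint is dropped.
              gcongr
              · exact mul_le_of_le_one_right' (h1 _)
              · exact mul_le_of_le_one_left' (h1 _)
    _ = 2 * ((∫⁻ x, h x * a x) + ∫⁻ x, h (x + r • (θ : Space d)) * a (x + r • (θ : Space d))) := by
        have h3 : Measurable fun x => h x * a x := hh.mul ham
        rw [lintegral_const_mul' _ _ (by simp), lintegral_add_left h3]
    _ = _ := by
        -- By translation invariance both integrals equal `∫ h a`; the total `4 ∫ h a` is twice the
        -- form `2 ∫ h a`.
        rw [lintegral_add_right_eq_self (fun x => h x * a x), hd2]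
        ring

/-- A lazy Metropolis step averages less than the uniform distribution on the chords of the level
sets. -/
theorem dirichlet_metropolis_le_hybridSlice (hd : 0 < d) (hq : IsRotInvDensity q)
    {f : Space d → ℝ} (hf : Measurable f) :
    dirichlet (mass K ρ) (metropolis K ρ q) f ≤ dirichlet (mass K ρ) (hybridSlice K ρ) f := by
  rw [hT.dirichlet_metropolis hd hq hf, hT.dirichlet_hybridSlice hf]
  refine setLIntegral_mono' measurableSet_Ioi fun t ht => ?_
  have hlev := hT.measurable_levelDensity t
  have hqm := hq.measurable
  have hI : Measurable fun z => ∫⁻ x, levelDensity K ρ t x *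
      levelDensity K ρ t (x + z) * ENNReal.ofReal ((f x - f (x + z)) ^ 2) :=
    Measurable.lintegral_prod_right' (f := fun p : Space d × Space d => levelDensity K ρ t p.2 *
      levelDensity K ρ t (p.2 + p.1) * ENNReal.ofReal ((f p.2 - f (p.2 + p.1)) ^ 2)) (by fun_prop)
  have hqI : Measurable fun z => ENNReal.ofReal (q z) * ∫⁻ x, levelDensity K ρ t x *
      levelDensity K ρ t (x + z) * ENNReal.ofReal ((f x - f (x + z)) ^ 2) :=
    hqm.ennreal_ofReal.mul hI
  rw [lintegral_polar hd hqI, ← lintegral_const_mul' _ _ (by simp)]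
  refine lintegral_mono fun θ => ?_
  set D := dirichlet (levelMass K ρ t)
    (chordKernel (levelDensity K ρ t) (hT.measurable_levelDensity t) θ) f
  calc _ ≤ 2⁻¹ * (sphereArea d * ∫⁻ r, ENNReal.ofReal (q ((r : ℝ) • (θ : Space d))) * (2 * D)
        ∂Measure.volumeIoiPow (d - 1)) := by
        gcongr with r
        exact hT.lintegral_shift_le ht θ r hf
    _ = 2⁻¹ * (1 * (2 * D)) := by
        -- The step bound is uniform in the length `r`, so only the total radial mass 1 enters; the
        -- lazy factor `2⁻¹` absorbs the 2.
        rw [lintegral_mul_const _ (by fun_prop), ← mul_assoc (sphereArea d),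
          hq.lintegral_radial hd θ]
    _ = D := by
        rw [one_mul, ← mul_assoc, ENNReal.inv_mul_cancel (by simp) (by simp), one_mul]

/-! ### From unnormalized forms to operators on `L²(π)`. -/

/-- The transition probabilities `κ` induce a Markov operator if they leave the target
distribution invariant. -/
lemma exists_markovOperator {κ : Space d → Measure (Space d)} (hκ : Measurable κ)
    (h1 : ∀ x, κ x univ ≤ 1) (hinv : (mass K ρ).bind κ = mass K ρ) :
    ∃ P : Lp ℝ 2 (target K ρ) →L[ℝ] Lp ℝ 2 (target K ρ), IsMarkovOperator (target K ρ) κ P := by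
  have := hT.isProbabilityMeasure_target
  have hinv' := hT.bind_target_eq hinv
  let κ' : Kernel (Space d) (Space d) := ⟨κ, hκ⟩
  exact exists_isMarkovOperator (κ := κ') (ae_isProbabilityMeasure_of_bind_eq h1 hinv') hinv'

lemma covGE {κ₁ κ₂ : Space d → Measure (Space d)} (h₁ : Measurable κ₁) (h₂ : Measurable κ₂)
    (hinv₁ : (mass K ρ).bind κ₁ = mass K ρ) (hinv₂ : (mass K ρ).bind κ₂ = mass K ρ)
    {P₁ P₂ : Lp ℝ 2 (target K ρ) →L[ℝ] Lp ℝ 2 (target K ρ)}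
    (hP₁ : IsMarkovOperator (target K ρ) κ₁ P₁) (hP₂ : IsMarkovOperator (target K ρ) κ₂ P₂)
    (h : ∀ f, Measurable f → dirichlet (mass K ρ) κ₁ f ≤ dirichlet (mass K ρ) κ₂ f) :
    CovGE P₁ P₂ := by
  have := hT.isProbabilityMeasure_target
  refine covGE_of_dirichlet_le (κ₁ := ⟨κ₁, h₁⟩) (κ₂ := ⟨κ₂, h₂⟩) (hT.bind_target_eq hinv₁)
    (hT.bind_target_eq hinv₂) hP₁ hP₂ fun f hf => ?_
  simp only [Kernel.coe_mk, hT.dirichlet_target]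
  gcongr
  exact h f hf

end IsTargetDensity

end Samplers

theorem theorem1 (d : ℕ) (hd : 0 < d)
    (K : Set (EuclideanSpace ℝ (Fin d))) (hK : MeasurableSet K)
    (hK0 : MeasureTheory.volume K ≠ 0)
    (ρ : EuclideanSpace ℝ (Fin d) → ℝ) (hρm : Measurable ρ) (hρpos : ∀ x ∈ K, 0 < ρ x)
    (hρint : MeasureTheory.IntegrableOn ρ K MeasureTheory.volume)
    (q : EuclideanSpace ℝ (Fin d) → ℝ) (hq : Samplers.IsRotInvDensity q) :
    ∃ M U H S : MeasureTheory.Lp ℝ 2 (Samplers.target K ρ) →L[ℝ]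
        MeasureTheory.Lp ℝ 2 (Samplers.target K ρ),
      Samplers.IsMarkovOperator (Samplers.target K ρ) (Samplers.metropolis K ρ q) M ∧
      Samplers.IsMarkovOperator (Samplers.target K ρ) (Samplers.hybridSlice K ρ) U ∧
      Samplers.IsMarkovOperator (Samplers.target K ρ) (Samplers.hitAndRun K ρ) H ∧
      Samplers.IsMarkovOperator (Samplers.target K ρ) (Samplers.simpleSlice K ρ) S ∧
      Samplers.CovGE M U ∧ Samplers.CovGE U H ∧ Samplers.CovGE U S := by
  have hT : Samplers.IsTargetDensity K ρ := ⟨hK, hK0, hρm, hρpos, hρint⟩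
  have mM := hT.measurable_metropolis hd hq
  have mU := hT.measurable_hybridSlice
  have mH := hT.measurable_hitAndRun
  have mS := hT.measurable_simpleSlice
  have iM := hT.bind_metropolis hd hq
  have iU := hT.bind_hybridSlice hd
  have iH := hT.bind_hitAndRun hd
  have iS := hT.bind_simpleSlice
  obtain ⟨M, hM⟩ := hT.exists_markovOperator mM (fun x => (hT.metropolis_univ hd hq x).le) iM
  obtain ⟨U, hU⟩ := hT.exists_markovOperator mU hT.hybridSlice_univ_le_one iU
  obtain ⟨H, hH⟩ := hT.exists_markovOperator mH hT.hitAndRun_univ_le_one iH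
  obtain ⟨S, hS⟩ := hT.exists_markovOperator mS hT.simpleSlice_univ_le_one iS
  refine ⟨M, U, H, S, hM, hU, hH, hS, ?_, ?_, ?_⟩
  · exact hT.covGE mM mU iM iU hM hU fun f hf => hT.dirichlet_metropolis_le_hybridSlice hd hq hf
  · exact hT.covGE mU mH iU iH hU hH fun f hf => hT.dirichlet_hybridSlice_le_hitAndRun hf
  · exact hT.covGE mU mS iU iS hU hS fun f hf => hT.dirichlet_hybridSlice_le_simpleSlice hd hf
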